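/- Let $n\ge 0$, let $\mathcal{O}=\mathbb{C}\{x_0,\dots,x_n\}$ be the ring of convergent power series (germs at $0$ of holomorphic functions on $\mathbb{C}^{n+1}$), with maximal ideal $\mathfrak{m}=\langle x_0,\dots,x_n\rangle$. Let $f\in\mathfrak{m}^3$ be a reduced equation (that is, $f\mathcal{O}$ is a radical ideal) of a hypersurface germ $D=\{f=0\}\subseteq(\mathbb{C}^{n+1},0)$ with an isolated singularity at $0$, i.e. in a neighbourhood of $0$ the point $0$ is the only common zero of $f,\frac{\partial f}{\partial x_0},\dots,\frac{\partial f}{\partial x_n}$. Suppose that $D$ is not quasihomogeneous, i.e. there are no holomorphic coordinates $y_0,\dots,y_n$ of $(\mathbb{C}^{n+1},0)$ and no unit $u\in\mathcal{O}^*$ such that $uf$ is a polynomial in $y_0,\dots,y_n$ that is weighted homogeneous with respect to some positive integer weights. Then every logarithmic vector field $$\delta\in\operatorname{Der}(-\log D)=\{\delta\in\operatorname{Der}_{\mathbb{C}}(\mathcal{O})\mid \delta(f)\in\mathcal{O}f\}$$ is nilpotent: $\delta(x_i)\in\mathfrak{m}$ for all $i$, and the matrix $\left(\frac{\partial\,\delta(x_i)}{\partial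 x_j}(0)\right)_{0\le i,j\le n}$ of its linear part is nilpotent. -/

import Mathlib

open Filter Topology

noncomputable section

namespace IsolatedSing

/-- Germs of complex valued functions form a `ℂ`-algebra (with the scalar multiplication that Mathlib
puts on germs). -/
instance germAlgebra (n : ℕ) : Algebra ℂ (Germ (𝓝 (0 : Fin (n + 1) → ℂ)) ℂ) :=
  Algebra.ofModule
    (fun c f g => by
      induction f using Germ.inductionOn with | _ f =>
      induction g using Germ.inductionOn with | _ g =>
      exact congrArg _ (smul_mul_assoc c f g))
    (fun c f g => by
      induction f using Germ.inductionOn with | _ f =>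
      induction g using Germ.inductionOn with | _ g =>
      exact congrArg _ (mul_smul_comm c f g))

/-- The ring `ℂ{x₀, …, xₙ}` of convergent power series, realised as the `ℂ`-algebra of germs at the
origin of holomorphic (complex analytic) functions on `ℂⁿ⁺¹`. -/
def analyticGerms (n : ℕ) : Subalgebra ℂ (Germ (𝓝 (0 : Fin (n + 1) → ℂ)) ℂ) where
  carrier := {g | ∃ φ : (Fin (n + 1) → ℂ) → ℂ, AnalyticAt ℂ φ 0 ∧ Germ.ofFun φ = g}
  mul_mem' := by
    rintro _ _ ⟨φ, hφ, rfl⟩ ⟨ψ, hψ, rfl⟩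
    exact ⟨φ * ψ, hφ.mul hψ, rfl⟩
  add_mem' := by
    rintro _ _ ⟨φ, hφ, rfl⟩ ⟨ψ, hψ, rfl⟩
    exact ⟨φ + ψ, hφ.add hψ, rfl⟩
  algebraMap_mem' := fun c => ⟨c • (1 : (Fin (n + 1) → ℂ) → ℂ),
    (analyticAt_const (v := (1 : ℂ))).const_smul, rfl⟩

/-- `𝒪 = ℂ{x₀, …, xₙ}`. -/
abbrev O (n : ℕ) : Type := analyticGerms n

/-- The germ of a function that is analytic at the origin. -/
def toGerm {n : ℕ} (φ : (Fin (n + 1) → ℂ) → ℂ) (hφ : AnalyticAt ℂ φ 0) : O n :=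
  ⟨Germ.ofFun φ, φ, hφ, rfl⟩

/-- The coordinate function `xᵢ`. -/
def coord {n : ℕ} (i : Fin (n + 1)) : O n :=
  toGerm (fun x => x i) ((ContinuousLinearMap.proj i : (Fin (n + 1) → ℂ) →L[ℂ] ℂ).analyticAt 0)

/-- The value `f(0)` of a germ, as a ring homomorphism. -/
def evalZero (n : ℕ) : O n →+* ℂ :=
  Germ.valueRingHom.comp (analyticGerms n).val.toRingHom

/-- The maximal ideal `𝔪` of `𝒪`: the germs vanishing at the origin. -/
def maxIdeal (n : ℕ) : Ideal (O n) := RingHom.ker (evalZero n)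

/-- The partial derivative `(∂f/∂xᵢ)(0)` of a germ at the origin. -/
def partialAtZero {n : ℕ} (i : Fin (n + 1)) (f : O n) : ℂ :=
  Germ.liftOn f.1 (fun φ => fderiv ℂ φ 0 (Pi.single i 1))
    (fun _ _ h => congrArg (fun L : (Fin (n + 1) → ℂ) →L[ℂ] ℂ => L (Pi.single i 1))
      (EventuallyEq.fderiv_eq h))

/-- The Jacobian matrix `(∂yᵢ/∂xⱼ)(0)` of a tuple of germs. -/
def jacobianAtZero {n : ℕ} (y : Fin (n + 1) → O n) : Matrix (Fin (n + 1)) (Fin (n + 1)) ℂ :=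
  Matrix.of fun i j => partialAtZero j (y i)

/-- `y₀, …, yₙ` is a holomorphic coordinate system of `(ℂⁿ⁺¹, 0)`. -/
def IsCoordinateSystem {n : ℕ} (y : Fin (n + 1) → O n) : Prop :=
  (∀ i, y i ∈ maxIdeal n) ∧ IsUnit (jacobianAtZero y)

/-- The germ `D = {f = 0}` has an isolated singularity at the origin: near `0`, the common zero set
of `f` and all its partial derivatives is exactly `{0}`. (This does not depend on the choice of the
representative `φ` of `f`.) -/
def HasIsolatedSingularity {n : ℕ} (f : O n) : Prop :=
  ∃ (φ : (Fin (n + 1) → ℂ) → ℂ) (hφ : AnalyticAt ℂ φ 0), toGerm φ hφ = f ∧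
    ∀ᶠ x in 𝓝 (0 : Fin (n + 1) → ℂ), (φ x = 0 ∧ fderiv ℂ φ x = 0) ↔ x = 0

/-- The germ `D = {f = 0}` is quasihomogeneous: in suitable holomorphic coordinates `y` some
defining equation `u f` of `D`, with `u` a unit, is a polynomial that is weighted homogeneous with
respect to positive integer weights. -/
def IsQuasihomogeneous {n : ℕ} (f : O n) : Prop :=
  ∃ (y : Fin (n + 1) → O n) (u : (O n)ˣ) (w : Fin (n + 1) → ℕ) (r : ℕ)
    (p : MvPolynomial (Fin (n + 1)) ℂ),
    IsCoordinateSystem y ∧ (∀ i, 0 < w i) ∧ p.IsWeightedHomogeneous w r ∧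
      (u : O n) * f = MvPolynomial.aeval y p

/-- The `𝒪`-module `Der(-log D) = {δ ∈ Der_ℂ(𝒪) | δ(f) ∈ 𝒪 f}` of logarithmic vector fields along
`D = {f = 0}`. -/
def logDer {n : ℕ} (f : O n) : Submodule (O n) (Derivation ℂ (O n) (O n)) where
  carrier := {δ | δ f ∈ Ideal.span {f}}
  zero_mem' := by simp
  add_mem' := fun {a b} ha hb => by
    simpa using (Ideal.span {f}).add_mem ha hb
  smul_mem' := fun c a ha => by
    simpa using (Ideal.span {f}).mul_mem_left c ha

/-- A vector field `δ = ∑ᵢ δ(xᵢ) ∂ᵢ` is nilpotent if all its coefficients `δ(xᵢ)` lie in `𝔪`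
(that is, `δ ∈ 𝔪 Der_ℂ(𝒪)`) and the matrix of its linear part is nilpotent. -/
def IsNilpotentVectorField {n : ℕ} (δ : Derivation ℂ (O n) (O n)) : Prop :=
  (∀ i, δ (coord i) ∈ maxIdeal n) ∧ IsNilpotent (jacobianAtZero fun i => δ (coord i))

end IsolatedSing

end

/-! Suppose a logarithmic field `δ` is not nilpotent; then `f` is shown to be quasihomogeneous.

Since `0` is an isolated singularity, the analytic Nullstellensatz gives `𝔪^k ⊆ T` for the Tjurina
ideal `T = ⟨f, ∂f⟩` (`HasIsolatedSingularity.exists_pow_le`). The ideal `T` is `δ`-stable, and a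
derivation sending some `xᵢ` to a unit cannot stabilise a proper ideal containing a power of `xᵢ`;
hence `δ(xᵢ) ∈ 𝔪` (`logDer_coord_mem`).

So `δ` acts on the finite-dimensional jet algebra `𝒪/𝔪^(2k+2)`, and its generalized eigenspaces
multiply by adding eigenvalues. Modulo `𝔪^(2k+2)` there are a unit `u` with `u f` of some eigenvalue
`c`, and coordinates `yᵢ` of eigenvalues `lᵢ`. The `lᵢ` are not all zero because the linear part is
not nilpotent. Hence `u f` is congruent to a polynomial `P(y)` all of whose monomials `y^α` satisfy
`∑ αᵢ lᵢ = c` (`exists_aeval_sub_mem_of_mem_eigen`).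

An isolated singularity forces, for each `i`, a monomial of `P` with at most one factor different
from `yᵢ` (`exists_support_sum_erase_le_one`). As `f ∈ 𝔪³`, this yields relations `a lᵢ + lⱼ = c`
with `a ≥ 2`. They exclude `c = 0`, and a `ℚ`-linear functional with value `1` at `c` turns the `lᵢ`
into positive rational weights (`exists_weights`). So `P` is weighted homogeneous.

Finally `P` is finitely determined: by Euler's relation and Nakayama `𝔪^k` lies in the ideal `J` of
partials of `P`, so the error lies in `𝔪 J²`, and Tougeron's implicit function argument absorbs it
into a change of coordinates (`exists_coordinateSystem_of_sub_mem`). Thus `u f = P(y')`.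

The Nullstellensatz is proved by induction on dimension: Weierstrass preparation and division, then
elimination of one variable with resultants. -/

noncomputable section

namespace IsolatedSing

/-! ### Hadamard's lemma, Cauchy integrals with parameters, generic Weierstrass division. -/

section Analytic

variable {E F : Type*} [NormedAddCommGroup E] [NormedSpace ℂ E]
  [NormedAddCommGroup F] [NormedSpace ℂ F]

/-- Hadamard's lemma: `f x = f 0 + G x x` with `G` analytic at the origin. -/
theorem exists_hadamard [CompleteSpace F] {f : E → F} (hf : AnalyticAt ℂ f 0) :
    ∃ G : E → E →L[ℂ] F, AnalyticAt ℂ G 0 ∧ ∀ᶠ x in 𝓝 0, f x = f 0 + G x x := by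
  obtain ⟨p, r, hp⟩ := hf
  have hrad : 0 < p.shift.radius := by
    rw [p.radius_shift]; exact hp.r_pos.trans_le hp.r_le
  have hG := p.shift.hasFPowerSeriesOnBall hrad
  refine ⟨p.shift.sum, hG.analyticAt, ?_⟩
  filter_upwards [Metric.eball_mem_nhds (0 : E) hp.r_pos, Metric.eball_mem_nhds (0 : E) hrad] with x hx hx'
  have h1 := hp.hasSum hx
  have h2 := (ContinuousLinearMap.apply ℂ F x).hasSum (hG.hasSum hx')
  simp only [zero_add] at h1 h2
  rw [← hasSum_nat_add_iff' 1] at h1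
  simp only [Finset.range_one, Finset.sum_singleton] at h1
  have h0 : p 0 (fun _ => x) = f 0 := hp.coeff_zero _
  rw [h0] at h1
  have h3 : (fun n => p (n + 1) fun _ => x) =
      fun n => (ContinuousLinearMap.apply ℂ F x) (p.shift n fun _ => x) := by
    funext n
    simp only [ContinuousLinearMap.apply_apply, FormalMultilinearSeries.shift]
    rw [ContinuousMultilinearMap.curryRight_apply]
    congr 1
    funext i
    refine Fin.lastCases ?_ (fun j => ?_) i <;> simp
  rw [h3] at h1
  have h4 := h1.unique h2
  simp only [ContinuousLinearMap.apply_apply] at h4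
  rw [← h4]; abel

variable {K : Type*} [TopologicalSpace K] [CompactSpace K]

/-- The pointwise action of a continuous multilinear map on continuous functions. -/
def multilinearOnContinuousMap {n : ℕ}
    (p : ContinuousMultilinearMap ℂ (fun _ : Fin n => E) F) :
    ContinuousMultilinearMap ℂ (fun _ : Fin n => C(K, E)) C(K, F) :=
  MultilinearMap.mkContinuous
    { toFun := fun v => ⟨fun k => p fun i => v i k, by fun_prop⟩
      map_update_add' := by
        intro _ v i x y
        ext k
        have h (z : C(K, E)) : (fun j => (Function.update v i z) j k) =
            Function.update (fun j => v j k) i (z k) := by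
          funext j
          by_cases hj : j = i
          · subst hj; simp
          · simp [hj]
        simp [h]
      map_update_smul' := by
        intro _ v i c x
        ext k
        have h (z : C(K, E)) : (fun j => (Function.update v i z) j k) =
            Function.update (fun j => v j k) i (z k) := by
          funext j
          by_cases hj : j = i
          · subst hj; simp
          · simp [hj]
        simp [h] }
    ‖p‖ (fun v => by
      rw [ContinuousMap.norm_le _ (by positivity)]
      intro k
      refine (p.le_opNorm _).trans ?_
      gcongr with i
      exact (v i).norm_coe_le_norm k)

/-- An analytic function acts analytically on small continuous functions. -/
theorem exists_analytic_comp_continuousMap (K : Type*) [TopologicalSpace K] [CompactSpace K]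
    [CompleteSpace F]
    {f : E → F} (hf : AnalyticAt ℂ f 0) :
    ∃ (ρ : ℝ) (Φ : C(K, E) → C(K, F)), 0 < ρ ∧
      (∀ x, ‖x‖ < ρ → AnalyticAt ℂ f x) ∧
      ∀ v : C(K, E), ‖v‖ < ρ → AnalyticAt ℂ Φ v ∧ ∀ k, Φ v k = f (v k) := by
  obtain ⟨p, r, hp⟩ := hf
  let q : FormalMultilinearSeries ℂ C(K, E) C(K, F) := fun n => multilinearOnContinuousMap (p n)
  have hq : r ≤ q.radius := hp.r_le.trans <| FormalMultilinearSeries.radius_le_of_le fun n =>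
    MultilinearMap.mkContinuous_norm_le _ (norm_nonneg _) _
  have hQ := (q.hasFPowerSeriesOnBall (hp.r_pos.trans_le hq)).mono hp.r_pos hq
  obtain ⟨ρ, hρ0, hρ⟩ := ENNReal.lt_iff_exists_real_btwn.1 hp.r_pos
  have hρ1 : 0 < ρ := by simpa using hρ.1
  have key (t : ℝ) (ht : t < ρ) : ENNReal.ofReal t < r :=
    (ENNReal.ofReal_le_ofReal ht.le).trans_lt hρ.2
  have hE (x : E) (hx : ‖x‖ < ρ) : x ∈ Metric.eball (0 : E) r := by
    simpa [← ofReal_norm] using key _ hx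
  refine ⟨ρ, q.sum, hρ1, fun x hx => hp.analyticAt_of_mem (hE x hx), fun v hv => ?_⟩
  have hv' : v ∈ Metric.eball (0 : C(K, E)) r := by simpa [← ofReal_norm] using key _ hv
  refine ⟨hQ.analyticAt_of_mem hv', fun k => ?_⟩
  have h1 := ContinuousMap.hasSum_apply (hQ.hasSum hv') k
  have h2 := hp.hasSum (hE (v k) ((v.norm_coe_le_norm k).trans_lt hv))
  simp only [zero_add] at h1 h2
  exact h1.unique h2

/-- The parameter interval of a circle. -/
abbrev CircleParam : Type := Set.Icc (0 : ℝ) (2 * Real.pi)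

/-- The Cauchy integral over the circle of radius `ρ`, as a continuous linear functional. -/
def circleCLM (ρ : ℝ) : C(CircleParam, ℂ) →L[ℂ] ℂ :=
  LinearMap.mkContinuous
    { toFun := fun f => (2 * Real.pi * Complex.I)⁻¹ * ∫ θ in (0 : ℝ)..2 * Real.pi,
        deriv (circleMap 0 ρ) θ * f (Set.projIcc 0 (2 * Real.pi) Real.two_pi_pos.le θ)
      map_add' := fun f g => by
        simp only [ContinuousMap.add_apply, mul_add]
        rw [intervalIntegral.integral_add, mul_add]
        · refine Continuous.intervalIntegrable ?_ _ _
          simp only [deriv_circleMap]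
          fun_prop
        · refine Continuous.intervalIntegrable ?_ _ _
          simp only [deriv_circleMap]
          fun_prop
      map_smul' := fun c f => by
        change _ * ∫ θ in (0 : ℝ)..2 * Real.pi, deriv (circleMap 0 ρ) θ * (c * _) = c * (_ * _)
        simp only [mul_left_comm _ c, intervalIntegral.integral_const_mul] }
    (‖(2 * Real.pi * Complex.I)⁻¹‖ * (|ρ| * |2 * Real.pi - 0|)) (fun f => by
      rw [LinearMap.coe_mk, AddHom.coe_mk, norm_mul, mul_assoc ‖_‖, mul_right_comm |ρ|]
      refine mul_le_mul_of_nonneg_left ?_ (norm_nonneg _)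
      refine intervalIntegral.norm_integral_le_of_norm_le_const fun θ _ => ?_
      rw [norm_mul]
      gcongr
      · simp
      · exact f.norm_coe_le_norm _)

theorem circleCLM_apply (ρ : ℝ) (f : C(CircleParam, ℂ)) (F : ℂ → ℂ)
    (h : ∀ θ, f θ = F (circleMap 0 ρ θ)) :
    circleCLM ρ f = (2 * Real.pi * Complex.I)⁻¹ * ∮ z in C(0, ρ), F z := by
  simp only [circleCLM, LinearMap.mkContinuous_apply, LinearMap.coe_mk, AddHom.coe_mk,
    circleIntegral]
  congr 1
  refine intervalIntegral.integral_congr fun θ hθ => ?_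
  rw [Set.uIcc_of_le Real.two_pi_pos.le] at hθ
  simp [h, Set.projIcc_of_mem _ hθ]

/-- The difference quotient of a monic polynomial, sorted by powers of `z`: its coefficients do not
involve `z`, so after Cauchy integration in `x` they become the coefficients of a remainder of
degree `< d` in `z`. The guard `j < m` keeps the natural subtraction exact. -/
theorem pow_add_sum_eq_add_sub_mul {R : Type*} [CommRing R] {d : ℕ} (x z : R) (c : Fin d → R) :
    x ^ d + ∑ m, c m * x ^ (m : ℕ) = z ^ d + ∑ m, c m * z ^ (m : ℕ) +
      (x - z) * ∑ j : Fin d, z ^ (j : ℕ) * (x ^ (d - 1 - j) +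
        ∑ m : Fin d, if j < m then c m * x ^ ((m : ℕ) - 1 - j) else 0) := by
  have geom (n : ℕ) : x ^ n - z ^ n = (x - z) * ∑ j ∈ Finset.range n, z ^ j * x ^ (n - 1 - j) := by
    rw [← neg_inj, neg_sub, ← neg_mul, neg_sub]
    exact ((Commute.all z x).mul_geom_sum₂ n).symm
  have h1 : ∑ j : Fin d, z ^ (j : ℕ) * x ^ (d - 1 - j) =
      ∑ j ∈ Finset.range d, z ^ j * x ^ (d - 1 - j) :=
    Fin.sum_univ_eq_sum_range (fun j => z ^ j * x ^ (d - 1 - j)) d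
  have h2 (m : Fin d) : ∑ j : Fin d, z ^ (j : ℕ) *
      (if j < m then c m * x ^ ((m : ℕ) - 1 - j) else 0) =
      c m * ∑ j ∈ Finset.range m, z ^ j * x ^ ((m : ℕ) - 1 - j) := by
    rw [Finset.mul_sum]
    simp only [Fin.lt_def]
    rw [Fin.sum_univ_eq_sum_range
      (fun j => z ^ j * (if j < (m : ℕ) then c m * x ^ ((m : ℕ) - 1 - j) else 0)) d]
    simp only [mul_ite, mul_zero]
    rw [← Finset.sum_filter]
    refine Finset.sum_congr ?_ fun j _ => by ring
    ext j
    simp only [Finset.mem_filter, Finset.mem_range]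
    have := m.2
    omega
  simp only [mul_add, Finset.sum_add_distrib, Finset.mul_sum (Finset.univ : Finset (Fin d))
    (fun _ => ite _ _ _)]
  rw [h1, Finset.sum_comm, Finset.sum_congr rfl fun m _ => h2 m, ← geom, Finset.mul_sum]
  have h3 : ∑ m : Fin d, (x - z) * (c m * ∑ j ∈ Finset.range m, z ^ j * x ^ ((m : ℕ) - 1 - j)) =
      ∑ m, c m * x ^ (m : ℕ) - ∑ m, c m * z ^ (m : ℕ) := by
    rw [← Finset.sum_sub_distrib]
    refine Finset.sum_congr rfl fun m _ => ?_
    rw [← mul_sub, geom]; ring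
  rw [h3]; ring

/-- The integrand identity behind Weierstrass division. With `Z = ζ - z`, `P = P(ζ)` and `p = P(z)`
it splits the Cauchy kernel `H/(ζ - z)` into `p` times the integrand of the quotient plus the
integrand of the remainder. -/
theorem mul_inverse_eq_smul_add_sum {A : Type*} [CommRing A] [Algebra ℂ A] {ι : Type*} [Fintype ι]
    (H : A) {P P' Z Z' : A} {p : ℂ} {w : ι → ℂ} {S : ι → A} (hP : P' * P = 1) (hZ : Z' * Z = 1)
    (h : P = algebraMap ℂ A p + Z * ∑ j, algebraMap ℂ A (w j) * S j) :
    H * Z' = p • (H * P' * Z') + ∑ j, w j • (H * P' * S j) := by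
  have : ∑ j, w j • (H * P' * S j) = H * P' * ∑ j, algebraMap ℂ A (w j) * S j := by
    rw [Finset.mul_sum]
    exact Finset.sum_congr rfl fun j _ => by rw [Algebra.smul_def]; ring
  rw [this, Algebra.smul_def]
  linear_combination (-(H * Z')) * hP + H * P' * Z' * h +
    (H * P' * ∑ j, algebraMap ℂ A (w j) * S j) * hZ

/-- Weierstrass division by the generic monic polynomial of degree `d`, whose lower coefficients
are parameters near the origin. -/
theorem exists_generic_division {E : Type*} [NormedAddCommGroup E] [NormedSpace ℂ E] (d : ℕ)
    {h : ℂ × E → ℂ} (hh : AnalyticAt ℂ h 0) :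
    ∃ (q : ℂ × E × (Fin d → ℂ) → ℂ) (r : E × (Fin d → ℂ) → Fin d → ℂ),
      AnalyticAt ℂ q 0 ∧ AnalyticAt ℂ r 0 ∧ ∀ᶠ x in 𝓝 (0 : ℂ × E × (Fin d → ℂ)),
        h (x.1, x.2.1) = q x * (x.1 ^ d + ∑ j, x.2.2 j * x.1 ^ (j : ℕ)) +
          ∑ j, r x.2 j * x.1 ^ (j : ℕ) := by
  obtain ⟨R, Φ, hR, hanal, hΦ⟩ := exists_analytic_comp_continuousMap CircleParam hh
  let ρ : ℝ := R / 2
  have hρ : 0 < ρ := by positivity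
  have hρR : ρ < R := half_lt_self hR
  let ζ : C(CircleParam, ℂ) := ⟨fun θ => circleMap 0 ρ θ, by fun_prop⟩
  have hζ (θ : CircleParam) : ζ θ = circleMap 0 ρ θ := rfl
  have hζn (θ : CircleParam) : ‖ζ θ‖ = ρ := by simp [hζ, abs_of_pos hρ]
  let A : E →L[ℂ] C(CircleParam, ℂ × E) := LinearMap.mkContinuous
    { toFun := fun a => ContinuousMap.const CircleParam ((0 : ℂ), a)
      map_add' := fun a b => by ext <;> simp
      map_smul' := fun c a => by ext <;> simp } 1 (fun a => by
        rw [ContinuousMap.norm_le _ (by positivity)]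
        intro θ
        simp)
  let v₀ : C(CircleParam, ℂ × E) := ⟨fun θ => (ζ θ, 0), by fun_prop⟩
  have hv (a : E) (θ : CircleParam) : (v₀ + A a) θ = (ζ θ, a) := by
    change ((ζ θ, 0) : ℂ × E) + (0, a) = _
    simp
  have hvn (a : E) (ha : ‖a‖ < ρ) : ‖v₀ + A a‖ < R := by
    refine lt_of_le_of_lt ?_ hρR
    rw [ContinuousMap.norm_le _ hρ.le]
    intro θ
    rw [hv, Prod.norm_mk, hζn, max_eq_left ha.le]
  -- Working in the Banach algebra of continuous functions on the circle reduces analytic dependence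
  -- of the integrals on parameters to composition of analytic maps.
  let H : E → C(CircleParam, ℂ) := fun a => Φ (v₀ + A a)
  have hHa : AnalyticAt ℂ H 0 := by
    have h0 : AnalyticAt ℂ Φ (v₀ + A 0) := (hΦ _ (hvn 0 (by simpa using hρ))).1
    exact h0.fun_comp (f := fun a => v₀ + A a) (analyticAt_const.add (A.analyticAt 0))
  have hH (a : E) (ha : ‖a‖ < ρ) (θ : CircleParam) : H a θ = h (ζ θ, a) := by
    rw [← hv]; exact (hΦ _ (hvn a ha)).2 θ
  let P : (Fin d → ℂ) → C(CircleParam, ℂ) := fun c => ζ ^ d + ∑ m, algebraMap ℂ C(CircleParam, ℂ) (c m) * ζ ^ (m : ℕ)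
  let S : (Fin d → ℂ) → Fin d → C(CircleParam, ℂ) := fun c j => ζ ^ (d - 1 - j) +
    ∑ m : Fin d, if j < m then algebraMap ℂ C(CircleParam, ℂ) (c m) * ζ ^ ((m : ℕ) - 1 - j) else 0
  let alg : ℂ →L[ℂ] C(CircleParam, ℂ) :=
    (Algebra.linearMap ℂ C(CircleParam, ℂ)).toContinuousLinearMap
  have hprojA (m : Fin d) :
      AnalyticAt ℂ (fun c : Fin d → ℂ => algebraMap ℂ C(CircleParam, ℂ) (c m)) 0 :=
    (alg.comp (ContinuousLinearMap.proj m : (Fin d → ℂ) →L[ℂ] ℂ)).analyticAt 0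
  have hPa : AnalyticAt ℂ P 0 := by
    refine analyticAt_const.add (Finset.analyticAt_fun_sum _ fun m _ => ?_)
    exact (hprojA m).mul analyticAt_const
  have hSa (j : Fin d) : AnalyticAt ℂ (fun c => S c j) 0 := by
    refine analyticAt_const.add (Finset.analyticAt_fun_sum _ fun m _ => ?_)
    split_ifs
    · exact (hprojA m).mul analyticAt_const
    · exact analyticAt_const
  have hζu : IsUnit ζ := by
    rw [ContinuousMap.isUnit_iff_forall_ne_zero]
    intro θ h0
    rw [← norm_eq_zero, hζn] at h0
    exact hρ.ne' h0
  let Z : ℂ → C(CircleParam, ℂ) := fun z => ζ - algebraMap ℂ C(CircleParam, ℂ) z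
  have hZa : AnalyticAt ℂ Z 0 := analyticAt_const.sub (alg.analyticAt 0)
  have hP0 : IsUnit (P 0) := by
    have : P 0 = ζ ^ d := by simp [P]
    rw [this]; exact hζu.pow d
  have hZ0 : IsUnit (Z 0) := by
    have : Z 0 = ζ := by simp only [Z, map_zero, sub_zero]
    rw [this]; exact hζu
  have hPi : AnalyticAt ℂ (fun c => Ring.inverse (P c)) 0 := by
    obtain ⟨u, hu⟩ := hP0
    have := analyticAt_inverse (𝕜 := ℂ) u
    rw [hu] at this
    exact this.fun_comp hPa
  have hZi : AnalyticAt ℂ (fun c => Ring.inverse (Z c)) 0 := by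
    obtain ⟨u, hu⟩ := hZ0
    have := analyticAt_inverse (𝕜 := ℂ) u
    rw [hu] at this
    exact this.fun_comp hZa
  -- The classical formulas: `q` is the Cauchy integral of `h / (P(ζ)(ζ - z))`, and `rⱼ` that of `h
  -- Sⱼ / P(ζ)`.
  refine ⟨fun x => circleCLM ρ (H x.2.1 * Ring.inverse (P x.2.2) * Ring.inverse (Z x.1)),
    fun y j => circleCLM ρ (H y.1 * Ring.inverse (P y.2) * S y.2 j), ?_, ?_, ?_⟩
  · have k1 : AnalyticAt ℂ (fun x : ℂ × E × (Fin d → ℂ) => H x.2.1) 0 :=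
      AnalyticAt.fun_comp (g := H) hHa (analyticAt_fst.fun_comp analyticAt_snd)
    have k2 : AnalyticAt ℂ (fun x : ℂ × E × (Fin d → ℂ) => Ring.inverse (P x.2.2)) 0 :=
      AnalyticAt.fun_comp (g := fun c => Ring.inverse (P c)) hPi
        (analyticAt_snd.fun_comp analyticAt_snd)
    have k3 : AnalyticAt ℂ (fun x : ℂ × E × (Fin d → ℂ) => Ring.inverse (Z x.1)) 0 :=
      AnalyticAt.fun_comp (g := fun c => Ring.inverse (Z c)) hZi analyticAt_fst
    exact AnalyticAt.fun_comp (g := circleCLM ρ) (ContinuousLinearMap.analyticAt _ _)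
      ((k1.mul k2).mul k3)
  · refine AnalyticAt.pi fun j => ?_
    have k1 : AnalyticAt ℂ (fun x : E × (Fin d → ℂ) => H x.1) 0 :=
      AnalyticAt.fun_comp (g := H) hHa analyticAt_fst
    have k2 : AnalyticAt ℂ (fun x : E × (Fin d → ℂ) => Ring.inverse (P x.2)) 0 :=
      AnalyticAt.fun_comp (g := fun c => Ring.inverse (P c)) hPi analyticAt_snd
    have k3 : AnalyticAt ℂ (fun x : E × (Fin d → ℂ) => S x.2 j) 0 :=
      AnalyticAt.fun_comp (g := fun c => S c j) (hSa j) analyticAt_snd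
    exact AnalyticAt.fun_comp (g := circleCLM ρ) (ContinuousLinearMap.analyticAt _ _)
      ((k1.mul k2).mul k3)
  · have c1 : ContinuousAt (fun x : ℂ × E × (Fin d → ℂ) => x.1) 0 := continuousAt_fst
    have c2 : ContinuousAt (fun x : ℂ × E × (Fin d → ℂ) => x.2.1) 0 := by fun_prop
    have c3 : ContinuousAt (fun x : ℂ × E × (Fin d → ℂ) => P x.2.2) 0 :=
      (AnalyticAt.fun_comp (g := P) (f := fun x : ℂ × E × (Fin d → ℂ) => x.2.2) hPa
        (analyticAt_snd.fun_comp analyticAt_snd)).continuousAt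
    have e1 := c1.eventually (Metric.ball_mem_nhds _ hρ)
    have e2 := c2.eventually (Metric.ball_mem_nhds _ hρ)
    have e3 := c3.eventually (Units.isOpen.mem_nhds hP0)
    filter_upwards [e1, e2, e3] with ⟨z, a, c⟩ hz ha hPu
    simp only [dist_zero_right, Prod.fst_zero, Prod.snd_zero] at hz ha
    change IsUnit (P c) at hPu
    have hZu : IsUnit (Z z) := by
      rw [ContinuousMap.isUnit_iff_forall_ne_zero]
      intro θ h0
      have : ζ θ = z := sub_eq_zero.1 h0
      rw [← this, hζn] at hz
      exact lt_irrefl _ hz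
    have hdiff : DifferentiableOn ℂ (fun w => h (w, a)) (Metric.closedBall 0 ρ) := by
      intro w hw
      refine ((hanal (w, a) ?_).differentiableAt.comp w
        (by fun_prop : DifferentiableAt ℂ (fun w : ℂ => (w, a)) w)).differentiableWithinAt
      rw [Prod.norm_mk, max_lt_iff]
      exact ⟨(mem_closedBall_zero_iff.1 hw).trans_lt hρR, ha.trans hρR⟩
    have hcauchy : circleCLM ρ (H a * Ring.inverse (Z z)) = h (z, a) := by
      rw [circleCLM_apply ρ _ (fun w => (w - z)⁻¹ • h (w, a)),
        hdiff.circleIntegral_sub_inv_smul (mem_ball_zero_iff.2 hz), smul_eq_mul, ← mul_assoc,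
        inv_mul_cancel₀ Complex.two_pi_I_ne_zero, one_mul]
      intro θ
      have : (Ring.inverse (Z z)) θ = (circleMap 0 ρ θ - z)⁻¹ := by
        refine eq_inv_of_mul_eq_one_left ?_
        exact congrArg (fun F : C(CircleParam, ℂ) => F θ) (Ring.inverse_mul_cancel _ hZu)
      rw [ContinuousMap.mul_apply, hH a ha, this, hζ, smul_eq_mul, mul_comm]
    have hid := pow_add_sum_eq_add_sub_mul ζ (algebraMap ℂ _ z)
      (fun m => algebraMap ℂ C(CircleParam, ℂ) (c m))
    have hPz : P c = algebraMap ℂ _ (z ^ d + ∑ m, c m * z ^ (m : ℕ)) +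
        Z z * ∑ j : Fin d, algebraMap ℂ _ (z ^ (j : ℕ)) * S c j := by
      simp only [P, S, Z, map_add, map_sum, map_mul, map_pow]
      exact hid
    have hsplit := mul_inverse_eq_smul_add_sum (H a) (Ring.inverse_mul_cancel _ hPu)
      (Ring.inverse_mul_cancel _ hZu) hPz
    have := congrArg (circleCLM ρ) hsplit
    rw [hcauchy] at this
    rw [this]
    simp only [map_add, map_sum, map_smul, smul_eq_mul]
    rw [mul_comm]
    congr 1
    exact Finset.sum_congr rfl fun j _ => mul_comm _ _

end Analytic

/-! ### The implicit function theorem; Weierstrass preparation and division. -/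

/-- The analytic implicit function theorem at the origin. -/
theorem exists_analytic_implicit {E F : Type*} [NormedAddCommGroup E] [NormedSpace ℂ E]
    [CompleteSpace E] [NormedAddCommGroup F] [NormedSpace ℂ F] [FiniteDimensional ℂ F]
    {Φ : E × F → F} (hΦ : AnalyticAt ℂ Φ 0) (h0 : Φ 0 = 0)
    (hinj : ∀ b, fderiv ℂ Φ 0 (0, b) = 0 → b = 0) :
    ∃ c : E → F, AnalyticAt ℂ c 0 ∧ c 0 = 0 ∧ ∀ᶠ a in 𝓝 0, Φ (a, c a) = 0 := by
  have : CompleteSpace F := FiniteDimensional.complete ℂ F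
  have hcd : ContDiffAt ℂ ⊤ Φ (0 : E × F) := hΦ.contDiffAt
  have hn : (⊤ : WithTop ℕ∞) ≠ 0 := by simp
  set D := fderiv ℂ Φ 0 ∘L .inr ℂ E F with hD
  have hDinj : Function.Injective (D : F →ₗ[ℂ] F) := by
    rw [injective_iff_map_eq_zero]
    exact fun b hb => hinj b (by simpa [hD] using hb)
  have hinv : D.IsInvertible := by
    refine ⟨(LinearEquiv.ofInjectiveEndo (D : F →ₗ[ℂ] F) hDinj).toContinuousLinearEquiv, ?_⟩
    ext b
    simp
  refine ⟨hcd.implicitFunction hn hinv, (hcd.contDiffAt_implicitFunction hn hinv).analyticAt,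
    hcd.implicitFunction_apply_self hn hinv, ?_⟩
  have := hcd.eventually_apply_implicitFunction hn hinv
  rwa [h0] at this

/-- A polynomial of degree `< d` divisible by `z^d` is zero. The coefficients vanish one at a time,
lowest first: divide by `z^k` and let `z → 0`. Continuity of `w` at `0` suffices. -/
theorem eq_zero_of_sum_eq_pow_mul {d : ℕ} (b : Fin d → ℂ) {w : ℂ → ℂ} (hw : ContinuousAt w 0)
    (h : ∀ᶠ z in 𝓝 0, ∑ j, b j * z ^ (j : ℕ) = z ^ d * w z) : b = 0 := by
  have key : ∀ k : ℕ, ∀ hk : k < d, b ⟨k, hk⟩ = 0 := by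
    intro k
    induction k using Nat.strong_induction_on with
    | _ k ih =>
      intro hk
      let s : ℂ → ℂ := fun z => ∑ j : Fin d, (if k < j then b j * z ^ ((j : ℕ) - k) else 0)
      have h1 : ∀ᶠ z in 𝓝[≠] (0 : ℂ), b ⟨k, hk⟩ = z ^ (d - k) * w z - s z := by
        filter_upwards [h.filter_mono nhdsWithin_le_nhds, self_mem_nhdsWithin] with z hz hz0
        have hz0 : z ≠ 0 := hz0
        have h2 : ∑ j, b j * z ^ (j : ℕ) = z ^ k * (b ⟨k, hk⟩ + s z) := by
          rw [mul_add, Finset.mul_sum, ← Finset.add_sum_erase _ _ (Finset.mem_univ ⟨k, hk⟩),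
            ← Finset.add_sum_erase (a := ⟨k, hk⟩) _ (fun j : Fin d => z ^ k * _)
              (Finset.mem_univ _)]
          simp only [lt_self_iff_false, if_false, mul_zero, zero_add]
          rw [mul_comm]
          congr 1
          refine Finset.sum_congr rfl fun j hj => ?_
          have hjk : (j : ℕ) ≠ k := fun e => (Finset.mem_erase.1 hj).1 (Fin.ext e)
          split_ifs with hlt
          · rw [mul_left_comm, ← pow_add, Nat.add_sub_cancel' hlt.le]
          · rw [show b j = 0 from ih j (by omega) j.2]; simp
        rw [h2, show z ^ d = z ^ k * z ^ (d - k) by rw [← pow_add, Nat.add_sub_cancel' hk.le],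
          mul_assoc] at hz
        have := mul_left_cancel₀ (pow_ne_zero k hz0) hz
        linear_combination this
      have h3 : Tendsto (fun z => z ^ (d - k) * w z - s z) (𝓝 0) (𝓝 0) := by
        have hs : ContinuousAt s 0 := by
          refine tendsto_finsetSum _ fun j _ => ?_
          split_ifs
          · exact (by fun_prop : ContinuousAt (fun z : ℂ => b j * z ^ ((j : ℕ) - k)) 0)
          · exact tendsto_const_nhds
        have hs0 : s 0 = 0 := by
          refine Finset.sum_eq_zero fun j _ => ?_
          split_ifs with hj
          · rw [zero_pow (by omega), mul_zero]
          · rfl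
        have hc : ContinuousAt (fun z => z ^ (d - k) * w z - s z) 0 :=
          ((continuousAt_id.pow _).mul hw).sub hs
        have := hc.tendsto
        rwa [hs0, zero_pow (by omega), zero_mul, sub_zero] at this
      exact tendsto_nhds_unique (tendsto_const_nhds.congr' h1)
        (h3.mono_left nhdsWithin_le_nhds)
  funext j
  exact key j j.2

section Weierstrass

variable {E : Type*} [NormedAddCommGroup E] [NormedSpace ℂ E]

/-- Weierstrass preparation. -/
theorem exists_weierstrass_preparation [CompleteSpace E] {g : ℂ × E → ℂ} (hg : AnalyticAt ℂ g 0)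
    (hreg : ¬ ∀ᶠ z in 𝓝 (0 : ℂ), g (z, 0) = 0) :
    ∃ (d : ℕ) (c : E → Fin d → ℂ) (u : ℂ × E → ℂ), AnalyticAt ℂ c 0 ∧ c 0 = 0 ∧
      AnalyticAt ℂ u 0 ∧ u 0 ≠ 0 ∧
      ∀ᶠ x in 𝓝 (0 : ℂ × E), g x = u x * (x.1 ^ d + ∑ j, c x.2 j * x.1 ^ (j : ℕ)) := by
  have hg0 : AnalyticAt ℂ (fun z : ℂ => g (z, 0)) 0 :=
    AnalyticAt.fun_comp (g := g) (f := fun z : ℂ => (z, (0 : E))) hg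
      (analyticAt_id.prod analyticAt_const)
  obtain ⟨d, v, hv, hv0, hgv⟩ := hg0.exists_eventuallyEq_pow_smul_nonzero_iff.2 hreg
  simp only [sub_zero, smul_eq_mul] at hgv
  obtain ⟨q, r, hq, hr, hqr⟩ := exists_generic_division d hg
  let ι : ℂ → ℂ × E × (Fin d → ℂ) := fun z => (z, 0, 0)
  have hι : Tendsto ι (𝓝 0) (𝓝 0) := by
    have : Continuous ι := by fun_prop
    exact this.tendsto 0
  have hqι : ContinuousAt (fun z => q (ι z)) 0 :=
    ContinuousAt.comp (g := q) (f := ι) hq.continuousAt hι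
  have e0 : ∀ᶠ z in 𝓝 (0 : ℂ), ∑ j, r 0 j * z ^ (j : ℕ) = z ^ d * (v z - q (ι z)) := by
    filter_upwards [hι.eventually hqr, hgv] with z h1 h2
    simp only [ι, Pi.zero_apply, zero_mul, Finset.sum_const_zero, add_zero] at h1
    change _ = _ + ∑ j, r 0 j * z ^ (j : ℕ) at h1
    simp only [ι]
    linear_combination h2 - h1
  have hr0 : r 0 = 0 := eq_zero_of_sum_eq_pow_mul _ (hv.continuousAt.sub hqι) e0
  have hq0 : q 0 = v 0 := by
    have h1 : ∀ᶠ z in 𝓝[≠] (0 : ℂ), v z - q (ι z) = 0 := by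
      filter_upwards [e0.filter_mono nhdsWithin_le_nhds, self_mem_nhdsWithin] with z hz hz0
      simp only [hr0, Pi.zero_apply, zero_mul, Finset.sum_const_zero] at hz
      exact (mul_eq_zero.1 hz.symm).resolve_left (pow_ne_zero _ hz0)
    have h2 : Tendsto (fun z => v z - q (ι z)) (𝓝[≠] 0) (𝓝 (v 0 - q (ι 0))) :=
      (hv.continuousAt.sub hqι).tendsto.mono_left nhdsWithin_le_nhds
    have := tendsto_nhds_unique (tendsto_const_nhds.congr' (h1.mono fun _ h => h.symm)) h2
    exact (sub_eq_zero.1 this.symm).symm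
  -- The aim is to solve `r(a, c(a)) = 0`, so that `g` becomes the quotient times the Weierstrass
  -- polynomial. Differentiating the division of `g(z, 0)` in the parameter direction `b` gives `q ∑
  -- bⱼ z^j + z^d ∂q = 0`; since `q(0) ≠ 0`, `∑ bⱼ z^j` is divisible by `z^d`.
  have hinj : ∀ b, fderiv ℂ r 0 (0, b) = 0 → b = 0 := by
    intro b hb
    let w : ℂ → ℂ := fun z => -(fderiv ℂ q (ι z) (0, 0, b)) / q (ι z)
    refine eq_zero_of_sum_eq_pow_mul b (w := w) ?_ ?_
    · refine ContinuousAt.div (ContinuousAt.neg ?_) hqι (by rw [show ι 0 = 0 from rfl, hq0]; exact hv0)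
      exact (ContinuousAt.comp (g := fderiv ℂ q) (f := ι) hq.fderiv.continuousAt hι).clm_apply
        continuousAt_const
    · have hqne : ∀ᶠ z in 𝓝 (0 : ℂ), q (ι z) ≠ 0 :=
        hqι.eventually_ne (by rw [show ι 0 = 0 from rfl, hq0]; exact hv0)
      filter_upwards [hι.eventually hqr.eventually_nhds, hι.eventually hq.eventually_analyticAt,
        hqne] with z h1 h2 h3
      let γ : ℂ → ℂ × E × (Fin d → ℂ) := fun t => (z, 0, t • b)
      have hγ : HasDerivAt γ (0, 0, b) 0 := by
        refine (hasDerivAt_const _ _).prodMk ((hasDerivAt_const _ _).prodMk ?_)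
        simpa using (hasDerivAt_id (0 : ℂ)).smul_const b
      have hγ0 : γ 0 = ι z := by simp [γ, ι]
      let γ' : ℂ → E × (Fin d → ℂ) := fun t => (0, t • b)
      have hγ' : HasDerivAt γ' (0, b) 0 := by
        refine (hasDerivAt_const _ _).prodMk ?_
        simpa using (hasDerivAt_id (0 : ℂ)).smul_const b
      have hγ'0 : γ' 0 = 0 := by simp [γ']
      have d1 : HasDerivAt (fun t => q (γ t)) (fderiv ℂ q (ι z) (0, 0, b)) 0 := by
        have : HasFDerivAt q (fderiv ℂ q (ι z)) (γ 0) := by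
          rw [hγ0]; exact h2.differentiableAt.hasFDerivAt
        exact this.comp_hasDerivAt 0 hγ
      have d2 : HasDerivAt (fun t => r (γ' t)) 0 0 := by
        have : HasFDerivAt r (fderiv ℂ r 0) (γ' 0) := by
          rw [hγ'0]; exact hr.differentiableAt.hasFDerivAt
        have h := this.comp_hasDerivAt 0 hγ'
        rw [hb] at h
        exact h
      have d3 : HasDerivAt (fun t : ℂ => z ^ d + ∑ j, (t • b) j * z ^ (j : ℕ))
          (∑ j, b j * z ^ (j : ℕ)) 0 := by
        have : HasDerivAt (fun t : ℂ => z ^ d + t * ∑ j, b j * z ^ (j : ℕ))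
            (∑ j, b j * z ^ (j : ℕ)) 0 := by
          simpa using ((hasDerivAt_id (0 : ℂ)).mul_const (∑ j, b j * z ^ (j : ℕ))).const_add (z ^ d)
        refine this.congr_of_eventuallyEq (Eventually.of_forall fun t => ?_)
        simp [Finset.mul_sum, mul_assoc]
      have d4 : HasDerivAt (fun t => ∑ j, r (γ' t) j * z ^ (j : ℕ)) 0 0 := by
        have : HasDerivAt (fun t => ∑ j, r (γ' t) j * z ^ (j : ℕ)) (∑ j : Fin d, 0 * z ^ (j : ℕ)) 0 :=
          HasDerivAt.fun_sum fun j _ => ((hasDerivAt_pi.1 d2) j).mul_const _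
        simpa using this
      have d5 := (d1.mul d3).add d4
      have d6 : HasDerivAt (fun _ : ℂ => g (z, 0)) 0 0 := hasDerivAt_const _ _
      have hγt : Tendsto γ (𝓝 0) (𝓝 (ι z)) := by
        rw [← hγ0]; exact hγ.continuousAt
      have d7 := d5.unique (d6.congr_of_eventuallyEq ?_)
      · simp only [hγ0, zero_smul, Pi.zero_apply, zero_mul, Finset.sum_const_zero, add_zero] at d7
        simp only [w]
        field_simp
        linear_combination d7
      · filter_upwards [hγt.eventually h1] with t ht
        exact ht.symm
  obtain ⟨c, hc, hc0, hrc⟩ := exists_analytic_implicit hr hr0 hinj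
  let κ : ℂ × E → ℂ × E × (Fin d → ℂ) := fun x => (x.1, x.2, c x.2)
  have hκ : AnalyticAt ℂ κ 0 :=
    analyticAt_fst.prod (analyticAt_snd.prod (AnalyticAt.fun_comp (g := c) hc analyticAt_snd))
  have hκ0 : κ 0 = 0 := by simp [κ, hc0]
  have hκt : Tendsto κ (𝓝 0) (𝓝 0) := by
    have := hκ.continuousAt.tendsto
    rwa [hκ0] at this
  refine ⟨d, c, fun x => q (κ x), hc, hc0, ?_, ?_, ?_⟩
  · exact AnalyticAt.fun_comp (g := q) (by rwa [hκ0]) hκ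
  · change q (κ 0) ≠ 0
    rw [hκ0, hq0]; exact hv0
  · have hsnd : Tendsto (fun x : ℂ × E => x.2) (𝓝 0) (𝓝 0) := continuous_snd.tendsto 0
    filter_upwards [hκt.eventually hqr, hsnd.eventually hrc] with x h1 h2
    simp only [κ, h2, Pi.zero_apply, zero_mul, Finset.sum_const_zero, add_zero] at h1
    exact h1

/-- Weierstrass division by a monic polynomial with coefficients vanishing at the origin. -/
theorem exists_weierstrass_division {d : ℕ} {c : E → Fin d → ℂ} (hc : AnalyticAt ℂ c 0)
    (hc0 : c 0 = 0) {h : ℂ × E → ℂ} (hh : AnalyticAt ℂ h 0) :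
    ∃ (q : ℂ × E → ℂ) (r : Fin d → E → ℂ), AnalyticAt ℂ q 0 ∧ (∀ j, AnalyticAt ℂ (r j) 0) ∧
      ∀ᶠ x in 𝓝 (0 : ℂ × E), h x = q x * (x.1 ^ d + ∑ j, c x.2 j * x.1 ^ (j : ℕ)) +
        ∑ j, r j x.2 * x.1 ^ (j : ℕ) := by
  obtain ⟨q, r, hq, hr, hqr⟩ := exists_generic_division d hh
  let κ : ℂ × E → ℂ × E × (Fin d → ℂ) := fun x => (x.1, x.2, c x.2)
  have hκ : AnalyticAt ℂ κ 0 :=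
    analyticAt_fst.prod (analyticAt_snd.prod (AnalyticAt.fun_comp (g := c) hc analyticAt_snd))
  have hκ0 : κ 0 = 0 := by simp [κ, hc0]
  have hκt : Tendsto κ (𝓝 0) (𝓝 0) := by
    have := hκ.continuousAt.tendsto
    rwa [hκ0] at this
  refine ⟨fun x => q (κ x), fun j a => r (a, c a) j, ?_, fun j => ?_, hκt.eventually hqr⟩
  · exact AnalyticAt.fun_comp (g := q) (by rwa [hκ0]) hκ
  · have : AnalyticAt ℂ (fun a => r (a, c a)) 0 :=
      AnalyticAt.fun_comp (g := r) (by rw [hc0]; exact hr) (analyticAt_id.prod hc)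
    exact (ContinuousLinearMap.proj j : (Fin d → ℂ) →L[ℂ] ℂ).analyticAt _ |>.fun_comp this

end Weierstrass

/-! ### Ideals of analytic functions up to equality near the origin; location of roots. -/

/-- The ring of functions on `E` that are analytic at the origin. -/
def analyticFunctions (E : Type*) [NormedAddCommGroup E] [NormedSpace ℂ E] : Subring (E → ℂ) where
  carrier := {φ | AnalyticAt ℂ φ 0}
  mul_mem' := fun h1 h2 => AnalyticAt.mul h1 h2
  one_mem' := analyticAt_const
  add_mem' := fun h1 h2 => AnalyticAt.add h1 h2
  zero_mem' := analyticAt_const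
  neg_mem' := fun h => AnalyticAt.neg h

section

variable {E F : Type*} [NormedAddCommGroup E] [NormedSpace ℂ E]
  [NormedAddCommGroup F] [NormedSpace ℂ F] {ι : Type*}

/-- The ideal of functions vanishing near the origin. -/
def nullFunctions (E : Type*) [NormedAddCommGroup E] [NormedSpace ℂ E] :
    Ideal (analyticFunctions E) where
  carrier := {φ | ∀ᶠ x in 𝓝 0, φ.1 x = 0}
  add_mem' := fun {a b} ha hb => by
    filter_upwards [ha, hb] with x h1 h2
    change a.1 x + b.1 x = 0
    rw [h1, h2, add_zero]
  zero_mem' := Eventually.of_forall fun _ => rfl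
  smul_mem' := fun c a ha => by
    filter_upwards [ha] with x h1
    change c.1 x * a.1 x = 0
    rw [h1, mul_zero]

/-- The ideal of analytic functions whose germ lies in the ideal generated by the germs of `g`. -/
def germIdeal (g : ι → analyticFunctions E) : Ideal (analyticFunctions E) :=
  Ideal.span (Set.range g) ⊔ nullFunctions E

theorem germIdeal_congr {g : ι → analyticFunctions E} {φ ψ : analyticFunctions E}
    (hφ : φ ∈ germIdeal g) (h : ∀ᶠ x in 𝓝 0, ψ.1 x = φ.1 x) : ψ ∈ germIdeal g := by
  have : ψ - φ ∈ nullFunctions E := by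
    filter_upwards [h] with x hx
    exact sub_eq_zero.2 hx
  simpa using add_mem hφ (Ideal.mem_sup_right (S := Ideal.span (Set.range g)) this)

theorem mem_germIdeal (g : ι → analyticFunctions E) (i : ι) : g i ∈ germIdeal g :=
  Ideal.mem_sup_left (Ideal.subset_span ⟨i, rfl⟩)

/-- Pull-back of functions along an analytic map preserving the origin. -/
def pullback (T : E → F) (hT : AnalyticAt ℂ T 0) (hT0 : T 0 = 0) :
    analyticFunctions F →+* analyticFunctions E where
  toFun φ := ⟨fun x => φ.1 (T x), by
    have h : AnalyticAt ℂ φ.1 (T 0) := by rw [hT0]; exact φ.2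
    exact AnalyticAt.fun_comp h hT⟩
  map_one' := rfl
  map_mul' _ _ := rfl
  map_zero' := rfl
  map_add' _ _ := rfl

theorem pullback_mem_germIdeal (T : E → F) (hT : AnalyticAt ℂ T 0) (hT0 : T 0 = 0)
    {g : ι → analyticFunctions F} {κ : Type*} {g' : κ → analyticFunctions E}
    (h : ∀ i, pullback T hT hT0 (g i) ∈ germIdeal g') {φ : analyticFunctions F}
    (hφ : φ ∈ germIdeal g) : pullback T hT hT0 φ ∈ germIdeal g' := by
  have : germIdeal g ≤ (germIdeal g').comap (pullback T hT hT0) := by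
    refine sup_le (Ideal.span_le.2 ?_) ?_
    · rintro _ ⟨i, rfl⟩
      exact h i
    · intro ψ hψ
      refine Ideal.mem_sup_right ?_
      have hc : Tendsto T (𝓝 0) (𝓝 0) := by
        have := hT.continuousAt.tendsto
        rwa [hT0] at this
      exact hc.eventually hψ
  exact this hφ

/-- Evaluation at a point of `E`. -/
def evalAt (a : E) : analyticFunctions E →+* ℂ :=
  (Pi.evalRingHom (fun _ : E => ℂ) a).comp (analyticFunctions E).subtype

/-- If `‖b‖ ≥ ε`, the equation gives `‖b‖^d ≤ ‖b‖^d ∑ ‖cⱼ(a)‖ ε^(-(d-j))`, and the sum is `< 1` for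
small `a`. Hence all roots over `a` lie in the region where the local identities hold. -/
theorem roots_tendsto {E : Type*} [NormedAddCommGroup E] {d : ℕ} {c : E → Fin d → ℂ} (hc : ContinuousAt c 0)
    (hc0 : c 0 = 0) {U : Set (ℂ × E)} (hU : U ∈ 𝓝 0) :
    ∀ᶠ a in 𝓝 (0 : E), ∀ b : ℂ, b ^ d + ∑ j, c a j * b ^ (j : ℕ) = 0 → (b, a) ∈ U := by
  obtain ⟨ε, hε, hεU⟩ := Metric.mem_nhds_iff.1 hU
  have h1 : ContinuousAt (fun a => ∑ j : Fin d, ‖c a j‖ * (ε⁻¹) ^ (d - (j : ℕ))) 0 := by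
    have : ∀ j, ContinuousAt (fun a => c a j) 0 := continuousAt_pi.1 hc
    fun_prop
  have h2 := h1.eventually_lt (continuousAt_const (y := (1 : ℝ))) (by simp [hc0])
  filter_upwards [h2, Metric.ball_mem_nhds (0 : E) hε] with a ha haε b hb
  refine hεU ?_
  rw [mem_ball_zero_iff, Prod.norm_mk, max_lt_iff]
  refine ⟨?_, mem_ball_zero_iff.1 haε⟩
  by_contra! hbε
  have hb0 : 0 < ‖b‖ := hε.trans_le hbε
  have h3 : ‖b‖ ^ d ≤ ∑ j : Fin d, ‖c a j‖ * ‖b‖ ^ (j : ℕ) := by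
    rw [← norm_pow, eq_neg_of_add_eq_zero_left hb, norm_neg]
    refine (norm_sum_le _ _).trans_eq ?_
    simp
  have h4 : ∑ j : Fin d, ‖c a j‖ * ‖b‖ ^ (j : ℕ) ≤
      ‖b‖ ^ d * ∑ j : Fin d, ‖c a j‖ * (ε⁻¹) ^ (d - (j : ℕ)) := by
    rw [Finset.mul_sum]
    refine Finset.sum_le_sum fun j _ => ?_
    rw [mul_left_comm]
    refine mul_le_mul_of_nonneg_left ?_ (norm_nonneg _)
    have : ‖b‖ ^ d = ‖b‖ ^ (j : ℕ) * ‖b‖ ^ (d - (j : ℕ)) := by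
      rw [← pow_add, Nat.add_sub_cancel' j.2.le]
    rw [this, mul_assoc, ← mul_pow]
    refine le_mul_of_one_le_right (by positivity) (one_le_pow₀ ?_)
    rw [← div_eq_mul_inv, one_le_div hε]
    exact hbε
  have h5 : ‖b‖ ^ d * ∑ j : Fin d, ‖c a j‖ * (ε⁻¹) ^ (d - (j : ℕ)) < ‖b‖ ^ d * 1 :=
    mul_lt_mul_of_pos_left ha (by positivity)
  linarith

end

/-! ### Resultants and common roots. -/

section Resultant

open Polynomial

/-- Since `W` is monic, padding the formal degree of `R` up to `e` only multiplies the resultant by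
a power of the leading coefficient `1`. -/
theorem exists_common_root_of_resultant_eq_zero {K : Type*} [Field K] [IsAlgClosed K]
    {W R : K[X]} {d e : ℕ} (hW : W.Monic) (hd : W.natDegree = d) (he : R.natDegree ≤ e)
    (h : resultant W R d e = 0) : ∃ b, W.IsRoot b ∧ R.IsRoot b := by
  subst hd
  obtain ⟨k, rfl⟩ := Nat.exists_eq_add_of_le he
  rw [resultant_add_right_deg _ _ _ _ _ le_rfl] at h
  have h1 : W.coeff W.natDegree = 1 := hW
  rw [h1, one_pow, one_mul, resultant_eq_zero_iff] at h
  have h2 := h.2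
  rw [isCoprime_iff_aeval_ne_zero_of_isAlgClosed K K] at h2
  push Not at h2
  simpa using h2

/-- If enough members of the pencil `∑ tⁱ Rᵢ` have a common root with `W`, then the `Rᵢ` and `W`
have a common root. -/
theorem exists_common_root_of_pencil {K : Type*} [Field K] [CharZero K] {W : K[X]} (hW : W ≠ 0)
    {r : ℕ} (R : Fin r → K[X])
    (h : ∀ t : Fin (W.natDegree * r + 1), ∃ b, W.IsRoot b ∧
      (∑ i : Fin r, C ((t : ℕ) : K) ^ (i : ℕ) * R i).IsRoot b) :
    ∃ b, W.IsRoot b ∧ ∀ i, (R i).IsRoot b := by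
  classical
  choose b hb hb' using h
  obtain ⟨β, hβ, hcard⟩ := Finset.exists_lt_card_fiber_of_mul_lt_card_of_maps_to
    (s := Finset.univ) (t := W.roots.toFinset) (f := b) (n := r)
    (fun t _ => by rw [Multiset.mem_toFinset, mem_roots hW]; exact hb t) (by
      rw [Finset.card_univ, Fintype.card_fin, Nat.lt_succ_iff]
      gcongr
      exact (Multiset.toFinset_card_le _).trans (card_roots' W))
  refine ⟨β, (mem_roots hW).1 (Multiset.mem_toFinset.1 hβ), ?_⟩
  let Q : K[X] := ∑ i : Fin r, C ((R i).eval β) * X ^ (i : ℕ)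
  have hQ : Q = 0 := by
    have hinj : Function.Injective (fun t : Fin (W.natDegree * r + 1) => ((t : ℕ) : K)) :=
      fun s t hst => Fin.ext (Nat.cast_injective hst)
    refine eq_zero_of_degree_lt_of_eval_finset_eq_zero
      ((Finset.univ.filter fun t => b t = β).image
        fun t : Fin (W.natDegree * r + 1) => ((t : ℕ) : K)) ?_ ?_
    · rw [Finset.card_image_of_injective _ hinj]
      refine lt_of_lt_of_le ((degree_sum_le _ _).trans_lt ((Finset.sup_lt_iff
        (WithBot.bot_lt_coe r)).2 fun i _ => ?_)) (Nat.cast_le.2 hcard.le)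
      exact (degree_C_mul_X_pow_le _ _).trans_lt (Nat.cast_lt.2 i.2)
    · intro x hx
      obtain ⟨t, ht, rfl⟩ := Finset.mem_image.1 hx
      have h1 := hb' t
      rw [(Finset.mem_filter.1 ht).2, IsRoot.def] at h1
      simp only [Q, eval_finsetSum, eval_mul, eval_C, eval_pow, eval_X] at h1 ⊢
      rw [← h1]
      exact Finset.sum_congr rfl fun i _ => mul_comm _ _
  intro i
  have h2 := congrArg (fun P : K[X] => P.coeff i) hQ
  simp only [Q, finsetSum_coeff, coeff_C_mul, coeff_X_pow, coeff_zero] at h2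
  rw [Finset.sum_eq_single i] at h2
  · simpa using h2
  · intro j _ hj
    rw [if_neg (fun e => hj (Fin.ext e.symm)), mul_zero]
  · simp

end Resultant

/-! ### The analytic Nullstellensatz at an isolated zero, by elimination. -/

section Nullstellensatz

open Polynomial

/-- Otherwise the whole `z`-axis would consist of common zeros. Thus isolatedness gives regularity
in `z` without a linear change of coordinates. -/
theorem exists_regular_member {E : Type*} [NormedAddCommGroup E] [NormedSpace ℂ E] {r : ℕ}
    (g : Fin r → analyticFunctions (ℂ × E))
    (hg : ∀ᶠ x in 𝓝 0, (∀ i, (g i).1 x = 0) → x = 0) :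
    ∃ i, ¬ ∀ᶠ z in 𝓝 (0 : ℂ), (g i).1 (z, 0) = 0 := by
  by_contra! h
  have hι : Tendsto (fun z : ℂ => (z, (0 : E))) (𝓝 0) (𝓝 0) :=
    (by fun_prop : Continuous fun z : ℂ => (z, (0 : E))).tendsto 0
  have h1 : ∀ᶠ z in 𝓝 (0 : ℂ), z = 0 := by
    filter_upwards [eventually_all.2 h, hι.eventually hg] with z h2 h3
    exact congrArg Prod.fst (h3 h2)
  have h2 : ∀ᶠ z in 𝓝[≠] (0 : ℂ), False := by
    filter_upwards [h1.filter_mono nhdsWithin_le_nhds, self_mem_nhdsWithin] with z h3 h4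
    exact h4 h3
  exact h2.exists.elim fun _ h => h

/-- By Hadamard's lemma a function vanishing at the origin is, near it, a combination of the
coordinates; so only these need be placed in the radical. -/
theorem pullback_vanishing_mem_radical {n : ℕ} {I : Ideal (analyticFunctions (ℂ × (Fin n → ℂ)))}
    (hI : nullFunctions _ ≤ I) (hz : (⟨Prod.fst, analyticAt_fst⟩ : analyticFunctions _) ∈ I.radical)
    (ha : ∀ j : Fin n, pullback (Prod.snd : ℂ × (Fin n → ℂ) → _) analyticAt_snd rfl
      ⟨fun a => a j, (ContinuousLinearMap.proj j : (Fin n → ℂ) →L[ℂ] ℂ).analyticAt 0⟩ ∈ I.radical)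
    {φ : analyticFunctions (ℂ × (Fin n → ℂ))} (hφ : φ.1 0 = 0) : φ ∈ I.radical := by
  obtain ⟨G, hG, hφG⟩ := exists_hadamard φ.2
  let G' (v : ℂ × (Fin n → ℂ)) : analyticFunctions (ℂ × (Fin n → ℂ)) :=
    ⟨fun x => G x v, (ContinuousLinearMap.apply ℂ ℂ v).analyticAt _ |>.fun_comp hG⟩
  let ψ : analyticFunctions (ℂ × (Fin n → ℂ)) := G' (1, 0) * ⟨Prod.fst, analyticAt_fst⟩ +
    ∑ j, G' (0, Pi.single j 1) * pullback (Prod.snd : ℂ × (Fin n → ℂ) → _) analyticAt_snd rfl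
      ⟨fun a => a j, (ContinuousLinearMap.proj j : (Fin n → ℂ) →L[ℂ] ℂ).analyticAt 0⟩
  have hψ : ψ ∈ I.radical :=
    add_mem (Ideal.mul_mem_left _ _ hz) (sum_mem fun j _ => Ideal.mul_mem_left _ _ (ha j))
  have hsub : φ - ψ ∈ nullFunctions _ := by
    filter_upwards [hφG] with x hx
    have h1 : ψ.1 x = G x (1, 0) * x.1 + ∑ j, G x (0, Pi.single j 1) * x.2 j := by
      have : evalAt x ψ = G x (1, 0) * x.1 + ∑ j, G x (0, Pi.single j 1) * x.2 j := by
        simp only [ψ, map_add, map_mul, map_sum]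
        rfl
      exact this
    have h2 : x = x.1 • ((1 : ℂ), (0 : Fin n → ℂ)) + ∑ j, x.2 j • ((0 : ℂ), Pi.single j (1 : ℂ)) := by
      ext
      · simp [Prod.fst_sum]
      · simp [Prod.snd_sum, Finset.sum_apply, Pi.single_apply]
    have h3 (L : ℂ × (Fin n → ℂ) →L[ℂ] ℂ) :
        L x = L (1, 0) * x.1 + ∑ j, L (0, Pi.single j 1) * x.2 j := by
      conv_lhs => rw [h2]
      simp only [map_add, map_sum, map_smul, smul_eq_mul, mul_comm]
    change φ.1 x - ψ.1 x = 0
    rw [h1, hx, hφ, zero_add, h3, sub_self]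
  have := add_mem (Ideal.le_radical (hI hsub)) hψ
  simpa using this

/-- Projection along `z`. Preparation gives a Weierstrass polynomial `W` in the ideal, division
replaces every `gᵢ` by a remainder `Rᵢ`, and the resultants of `W` with the members `∑ tⁱ Rᵢ` of a
pencil lie in the ideal and depend on `a` alone. A common zero `a` of enough of them lifts to a
common zero `(b, a)` of the `gᵢ`, so they have an isolated common zero and `ih` applies to them. -/
theorem analytic_nullstellensatz_succ {n : ℕ}
    (ih : ∀ (r : ℕ) (g : Fin r → analyticFunctions (Fin n → ℂ)),
      (∀ᶠ x in 𝓝 0, (∀ i, (g i).1 x = 0) → x = 0) →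
      ∀ φ : analyticFunctions (Fin n → ℂ), φ.1 0 = 0 → φ ∈ (germIdeal g).radical)
    {r : ℕ} (g : Fin r → analyticFunctions (ℂ × (Fin n → ℂ)))
    (hg : ∀ᶠ x in 𝓝 0, (∀ i, (g i).1 x = 0) → x = 0)
    (φ : analyticFunctions (ℂ × (Fin n → ℂ))) (hφ : φ.1 0 = 0) : φ ∈ (germIdeal g).radical := by
  let A := analyticFunctions (Fin n → ℂ)
  let B := analyticFunctions (ℂ × (Fin n → ℂ))
  obtain ⟨i₀, hi₀⟩ := exists_regular_member g hg
  obtain ⟨d, c, u, hc, hc0, hu, hu0, hprep⟩ := exists_weierstrass_preparation (g i₀).2 hi₀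
  choose q ρ hq hρ hdiv using fun i => exists_weierstrass_division hc hc0 (g i).2
  let π : A →+* B := pullback Prod.snd analyticAt_snd rfl
  let z : B := ⟨Prod.fst, analyticAt_fst⟩
  let ev : A[X] →+* B := eval₂RingHom π z
  have hev (P : A[X]) (x : ℂ × (Fin n → ℂ)) : (ev P).1 x = (P.map (evalAt x.2)).eval x.1 := by
    change evalAt x (eval₂ π z P) = _
    rw [hom_eval₂, eval_map]
    rfl
  let cA (j : Fin d) : A := ⟨fun a => c a j,
    (ContinuousLinearMap.proj j : (Fin d → ℂ) →L[ℂ] ℂ).analyticAt _ |>.fun_comp hc⟩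
  let W : A[X] := X ^ d + ∑ j : Fin d, C (cA j) * X ^ (j : ℕ)
  let R (i : Fin r) : A[X] := ∑ j : Fin d, C (⟨ρ i j, hρ i j⟩ : A) * X ^ (j : ℕ)
  have hdeg (b : Fin d → A) : (∑ j : Fin d, C (b j) * X ^ (j : ℕ)).degree < (d : WithBot ℕ) :=
    (degree_sum_le _ _).trans_lt ((Finset.sup_lt_iff (WithBot.bot_lt_coe d)).2 fun (j : Fin d) _ =>
      (degree_C_mul_X_pow_le _ _).trans_lt (Nat.cast_lt.2 j.2))
  have hWm : W.Monic := monic_X_pow_add (hdeg _)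
  have hWd : W.natDegree = d := by
    have h := degree_add_eq_left_of_degree_lt (p := (X : A[X]) ^ d) (q := ∑ j : Fin d, C (cA j) *
      X ^ (j : ℕ)) (by rw [degree_X_pow]; exact hdeg _)
    rw [degree_X_pow] at h
    exact natDegree_eq_of_degree_eq_some h
  have hWe (a : Fin n → ℂ) (b : ℂ) :
      (W.map (evalAt a)).eval b = b ^ d + ∑ j, c a j * b ^ (j : ℕ) := by
    simp only [W, Polynomial.map_add, Polynomial.map_pow, map_X, Polynomial.map_sum,
      Polynomial.map_mul, map_C, eval_add, eval_pow, eval_X, eval_finsetSum, eval_mul, eval_C]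
    rfl
  have hRe (i : Fin r) (a : Fin n → ℂ) (b : ℂ) :
      ((R i).map (evalAt a)).eval b = ∑ j, ρ i j a * b ^ (j : ℕ) := by
    simp only [R, Polynomial.map_pow, map_X, Polynomial.map_sum,
      Polynomial.map_mul, map_C, eval_pow, eval_X, eval_finsetSum, eval_mul, eval_C]
    rfl
  let I := germIdeal g
  have hWI : ev W ∈ I := by
    let u' : B := ⟨fun x => (u x)⁻¹, hu.fun_inv hu0⟩
    refine germIdeal_congr (Ideal.mul_mem_left _ u' (mem_germIdeal g i₀)) ?_
    filter_upwards [hprep, hu.continuousAt.eventually_ne hu0] with x h1 h2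
    change _ = (u x)⁻¹ * (g i₀).1 x
    rw [h1, inv_mul_cancel_left₀ h2, hev, hWe]
  have hRI (i : Fin r) : ev (R i) ∈ I := by
    let q' : B := ⟨q i, hq i⟩
    refine germIdeal_congr (sub_mem (mem_germIdeal g i) (Ideal.mul_mem_left _ q' hWI)) ?_
    filter_upwards [hdiv i] with x h1
    change _ = (g i).1 x - q i x * (ev W).1 x
    rw [h1, hev, hev, hWe, hRe]
    ring
  let S (t : ℕ) : A[X] := ∑ i : Fin r, C (t : A) ^ (i : ℕ) * R i
  have hSI (t : ℕ) : ev (S t) ∈ I := by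
    simp only [S, map_sum, map_mul]
    exact sum_mem fun i _ => Ideal.mul_mem_left _ _ (hRI i)
  -- The formal degree is taken to be `d + 1` rather than `d`, so that it is nonzero even when `d =
  -- 0`, as the Bézout identity for the resultant requires.
  have hSd (t : ℕ) : (S t).natDegree ≤ d + 1 := by
    refine natDegree_sum_le_of_forall_le _ _ fun i _ => ?_
    rw [← C_pow]
    refine (natDegree_C_mul_le _ _).trans ?_
    exact (natDegree_le_of_degree_le (hdeg _).le).trans (Nat.le_succ d)
  let N (t : Fin (d * r + 1)) : A := resultant W (S t) d (d + 1)
  have hNI (t : Fin (d * r + 1)) : π (N t) ∈ I := by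
    obtain ⟨p, p', -, -, h⟩ := exists_mul_add_mul_eq_C_resultant W (S t) hWd.le (hSd t)
      (Or.inr (Nat.succ_ne_zero d))
    have h1 : ev (C (N t)) = π (N t) := eval₂_C _ _
    rw [← h1, ← h, map_add, map_mul, map_mul]
    exact add_mem (Ideal.mul_mem_right _ _ hWI) (Ideal.mul_mem_right _ _ (hSI t))
  have hN : ∀ᶠ a in 𝓝 (0 : Fin n → ℂ), (∀ t, (N t).1 a = 0) → a = 0 := by
    have hU : ∀ᶠ x in 𝓝 (0 : ℂ × (Fin n → ℂ)), (∀ i, (g i).1 x = q i x *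
        (x.1 ^ d + ∑ j, c x.2 j * x.1 ^ (j : ℕ)) + ∑ j, ρ i j x.2 * x.1 ^ (j : ℕ)) ∧
        ((∀ i, (g i).1 x = 0) → x = 0) := (eventually_all.2 hdiv).and hg
    filter_upwards [roots_tendsto hc.continuousAt hc0 hU] with a ha hNa
    have hWa : (W.map (evalAt a)).natDegree = d := by rw [hWm.natDegree_map, hWd]
    obtain ⟨b, hb, hbR⟩ := exists_common_root_of_pencil (hWm.map (evalAt a)).ne_zero
      (fun i => (R i).map (evalAt a)) (fun t => by
        have h1 := hNa (t.cast (by rw [hWa]))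
        have h2 : resultant (W.map (evalAt a)) ((S t).map (evalAt a)) d (d + 1) = 0 := by
          rw [resultant_map_map]
          exact h1
        obtain ⟨b, h3, h4⟩ := exists_common_root_of_resultant_eq_zero (hWm.map _) hWa
          (natDegree_map_le.trans (hSd t)) h2
        refine ⟨b, h3, ?_⟩
        simpa [S, Polynomial.map_sum] using h4)
    rw [IsRoot.def, hWe] at hb
    have h1 := ha b hb
    have h2 : (b, a) = 0 := by
      refine h1.2 fun i => ?_
      rw [h1.1 i]
      have := hbR i
      rw [IsRoot.def, hRe] at this
      simp only [hb, this, mul_zero, add_zero]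
    exact congrArg Prod.snd h2
  have hA (ψ : A) (hψ : ψ.1 0 = 0) : π ψ ∈ I.radical := by
    obtain ⟨k, hk⟩ := ih _ N hN ψ hψ
    exact ⟨k, by rw [← map_pow]; exact pullback_mem_germIdeal _ _ _ hNI hk⟩
  refine pullback_vanishing_mem_radical le_sup_right ?_ (fun j => hA _ rfl) hφ
  refine Ideal.radical_isRadical I ⟨d, ?_⟩
  -- Modulo `W`, `z^d` is a combination of the `cⱼ`, which vanish at the origin and are therefore
  -- already in the radical.
  have h1 : z ^ d = ev W - ∑ j : Fin d, π (cA j) * z ^ (j : ℕ) := by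
    simp [W, ev, eval₂_finsetSum]
  change z ^ d ∈ _
  rw [h1]
  refine sub_mem (Ideal.le_radical hWI) (sum_mem fun j _ => Ideal.mul_mem_right _ _ (hA _ ?_))
  change c 0 j = 0
  rw [hc0]; rfl

/-- The analytic Nullstellensatz for an isolated common zero: if the origin is an isolated common
zero of `g`, a power of every function vanishing at the origin lies in the ideal of `g`. -/
theorem analytic_nullstellensatz (n r : ℕ) (g : Fin r → analyticFunctions (Fin n → ℂ))
    (hg : ∀ᶠ x in 𝓝 0, (∀ i, (g i).1 x = 0) → x = 0)
    (φ : analyticFunctions (Fin n → ℂ)) (hφ : φ.1 0 = 0) : φ ∈ (germIdeal g).radical := by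
  induction n generalizing r with
  | zero =>
    refine Ideal.le_radical (Ideal.mem_sup_right (Eventually.of_forall fun x => ?_))
    rw [Subsingleton.elim x 0, hφ]
  | succ n ih =>
    let e : (ℂ × (Fin n → ℂ)) ≃L[ℂ] (Fin (n + 1) → ℂ) := Fin.consEquivL ℂ fun _ => ℂ
    let T := pullback e (e.analyticAt 0) e.map_zero
    let T' := pullback e.symm (e.symm.analyticAt 0) e.symm.map_zero
    have hTT (ψ) : T' (T ψ) = ψ := Subtype.ext (funext fun x => congrArg ψ.1 (e.apply_symm_apply x))
    have h1 : ∀ᶠ x in 𝓝 0, (∀ i, (T (g i)).1 x = 0) → x = 0 := by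
      have he : Tendsto e (𝓝 0) (𝓝 0) := by simpa using e.continuous.tendsto 0
      filter_upwards [he.eventually hg] with x h2 h3
      exact e.map_eq_zero_iff.1 (h2 h3)
    obtain ⟨k, hk⟩ := analytic_nullstellensatz_succ ih (fun i => T (g i)) h1 (T φ)
      (by change φ.1 (e 0) = 0; rw [e.map_zero, hφ])
    refine ⟨k, ?_⟩
    rw [← hTT φ, ← map_pow]
    refine pullback_mem_germIdeal _ _ _ (fun i => ?_) hk
    change T' (T (g i)) ∈ _
    rw [hTT]
    exact mem_germIdeal g i

end Nullstellensatz

/-! ### The local ring of germs, its partial derivatives and the Tjurina ideal. -/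

section GermRing

variable {n : ℕ}

theorem exists_rep (f : O n) :
    ∃ (φ : (Fin (n + 1) → ℂ) → ℂ) (hφ : AnalyticAt ℂ φ 0), toGerm φ hφ = f := by
  obtain ⟨_, φ, hφ, rfl⟩ := f
  exact ⟨φ, hφ, rfl⟩

theorem toGerm_eq_iff {φ ψ : (Fin (n + 1) → ℂ) → ℂ} (hφ : AnalyticAt ℂ φ 0)
    (hψ : AnalyticAt ℂ ψ 0) : toGerm φ hφ = toGerm ψ hψ ↔ ∀ᶠ x in 𝓝 0, φ x = ψ x :=
  Subtype.ext_iff.trans Germ.coe_eq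

/-- The germ of an analytic function, as a ring homomorphism. -/
def germHom (n : ℕ) : analyticFunctions (Fin (n + 1) → ℂ) →+* O n where
  toFun φ := toGerm φ.1 φ.2
  map_one' := rfl
  map_mul' _ _ := rfl
  map_zero' := rfl
  map_add' _ _ := rfl

theorem evalZero_toGerm {φ : (Fin (n + 1) → ℂ) → ℂ} (hφ : AnalyticAt ℂ φ 0) :
    evalZero n (toGerm φ hφ) = φ 0 := rfl

theorem mem_maxIdeal {f : O n} : f ∈ maxIdeal n ↔ evalZero n f = 0 := Iff.rfl

theorem coord_mem (i : Fin (n + 1)) : coord i ∈ maxIdeal n := rfl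

theorem algebraMap_eq_toGerm (c : ℂ) :
    algebraMap ℂ (O n) c = toGerm (fun _ => c) analyticAt_const := by
  refine Subtype.ext ?_
  change (Germ.ofFun fun _ => c • (1 : ℂ)) = Germ.ofFun fun _ => c
  simp

theorem evalZero_algebraMap (c : ℂ) : evalZero n (algebraMap ℂ (O n) c) = c := by
  rw [algebraMap_eq_toGerm, evalZero_toGerm]

theorem isUnit_iff_evalZero_ne_zero {f : O n} : IsUnit f ↔ evalZero n f ≠ 0 := by
  refine ⟨fun h => (h.map (evalZero n)).ne_zero, fun h => ?_⟩
  obtain ⟨φ, hφ, rfl⟩ := exists_rep f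
  refine IsUnit.of_mul_eq_one (toGerm (fun x => (φ x)⁻¹) (hφ.fun_inv h)) ?_
  refine (toGerm_eq_iff (hφ.mul (hφ.fun_inv h)) analyticAt_const).2 ?_
  filter_upwards [hφ.continuousAt.eventually_ne h] with x hx
  exact mul_inv_cancel₀ hx

instance : Nontrivial (O n) := (evalZero n).domain_nontrivial

instance : IsLocalRing (O n) := IsLocalRing.of_nonunits_add fun a b ha hb => by
  rw [mem_nonunits_iff, isUnit_iff_evalZero_ne_zero, not_not] at *
  rw [map_add, ha, hb, add_zero]

theorem maxIdeal_eq_maximalIdeal : maxIdeal n = IsLocalRing.maximalIdeal (O n) := by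
  ext f
  rw [IsLocalRing.mem_maximalIdeal, mem_nonunits_iff, isUnit_iff_evalZero_ne_zero, not_not,
    mem_maxIdeal]

theorem isUnit_of_notMem_maxIdeal {f : O n} (h : f ∉ maxIdeal n) : IsUnit f :=
  isUnit_iff_evalZero_ne_zero.2 h

theorem one_notMem_maxIdeal : (1 : O n) ∉ maxIdeal n := by
  rw [mem_maxIdeal, map_one]; exact one_ne_zero

theorem maxIdeal_le_jacobson_bot : maxIdeal n ≤ Ideal.jacobson ⊥ := by
  rw [maxIdeal_eq_maximalIdeal, IsLocalRing.jacobson_eq_maximalIdeal _ bot_ne_top]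

theorem sub_algebraMap_mem (f : O n) : f - algebraMap ℂ (O n) (evalZero n f) ∈ maxIdeal n := by
  rw [mem_maxIdeal, map_sub, evalZero_algebraMap, sub_self]

theorem maxIdeal_eq_span_coord : maxIdeal n = Ideal.span (Set.range coord) := by
  refine le_antisymm (fun f hf => ?_) (Ideal.span_le.2 ?_)
  · obtain ⟨φ, hφ, rfl⟩ := exists_rep f
    obtain ⟨G, hG, hφG⟩ := exists_hadamard hφ
    have hGi (i : Fin (n + 1)) : AnalyticAt ℂ (fun x => G x (Pi.single i 1)) 0 :=
      (ContinuousLinearMap.apply ℂ ℂ (Pi.single i (1 : ℂ))).analyticAt _ |>.fun_comp hG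
    have h1 : toGerm φ hφ = ∑ i, toGerm _ (hGi i) * coord i := by
      let F : analyticFunctions (Fin (n + 1) → ℂ) := ∑ i, ⟨_, hGi i⟩ * ⟨fun x => x i,
        (ContinuousLinearMap.proj i : (Fin (n + 1) → ℂ) →L[ℂ] ℂ).analyticAt 0⟩
      have h2 : toGerm F.1 F.2 = ∑ i, toGerm _ (hGi i) * coord i := by
        change germHom n F = _
        simp only [F, map_sum, map_mul]
        rfl
      rw [← h2]
      refine (toGerm_eq_iff hφ F.2).2 ?_
      filter_upwards [hφG] with x hx
      have h0 : φ 0 = 0 := hf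
      have h3 (L : (Fin (n + 1) → ℂ) →L[ℂ] ℂ) : L x = ∑ i, L (Pi.single i 1) * x i := by
        conv_lhs => rw [pi_eq_sum_univ' x]
        simp only [map_sum, map_smul, smul_eq_mul, mul_comm]
      rw [hx, h0, zero_add, h3]
      have h4 (F : Fin (n + 1) → analyticFunctions (Fin (n + 1) → ℂ)) :
          (∑ i, F i).1 x = ∑ i, (F i).1 x := map_sum (evalAt x) _ _
      rw [h4]
      rfl
    rw [h1]
    exact sum_mem fun i _ => Ideal.mul_mem_left _ _ (Ideal.subset_span ⟨i, rfl⟩)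
  · rintro _ ⟨i, rfl⟩
    exact coord_mem i

theorem maxIdeal_fg : (maxIdeal n).FG := by
  rw [maxIdeal_eq_span_coord]
  exact Submodule.fg_span (Set.finite_range _)

/-- The partial derivative of a germ of a function, as a germ. -/
def partialGerm (i : Fin (n + 1)) (g : Germ (𝓝 (0 : Fin (n + 1) → ℂ)) ℂ) :
    Germ (𝓝 (0 : Fin (n + 1) → ℂ)) ℂ :=
  Germ.liftOn g (fun φ => Germ.ofFun fun x => fderiv ℂ φ x (Pi.single i 1)) fun φ ψ h => by
    refine Germ.coe_eq.2 ?_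
    filter_upwards [EventuallyEq.fderiv (𝕜 := ℂ) h] with x hx
    rw [hx]

theorem analyticAt_partial {φ : (Fin (n + 1) → ℂ) → ℂ} (hφ : AnalyticAt ℂ φ 0) (i : Fin (n + 1)) :
    AnalyticAt ℂ (fun x => fderiv ℂ φ x (Pi.single i 1)) 0 :=
  (ContinuousLinearMap.apply ℂ ℂ (Pi.single i (1 : ℂ))).analyticAt _ |>.fun_comp hφ.fderiv

/-- The partial derivative `∂/∂xᵢ` as a derivation of `𝒪`. -/
def partialDer (i : Fin (n + 1)) : Derivation ℂ (O n) (O n) :=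
  Derivation.mk'
    { toFun := fun f => ⟨partialGerm i f.1, by
        obtain ⟨φ, hφ, rfl⟩ := exists_rep f
        exact ⟨_, analyticAt_partial hφ i, rfl⟩⟩
      map_add' := fun f g => by
        obtain ⟨φ, hφ, rfl⟩ := exists_rep f
        obtain ⟨ψ, hψ, rfl⟩ := exists_rep g
        refine (toGerm_eq_iff (analyticAt_partial (hφ.add hψ) i)
          ((analyticAt_partial hφ i).add (analyticAt_partial hψ i))).2 ?_
        filter_upwards [hφ.eventually_analyticAt, hψ.eventually_analyticAt] with x h1 h2
        rw [fderiv_add h1.differentiableAt h2.differentiableAt]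
        rfl
      map_smul' := fun c f => by
        obtain ⟨φ, hφ, rfl⟩ := exists_rep f
        refine (toGerm_eq_iff (analyticAt_partial (analyticAt_const.mul hφ) i)
          (analyticAt_const.mul (analyticAt_partial hφ i))).2 ?_
        filter_upwards [hφ.eventually_analyticAt] with x h1
        rw [show ((fun _ => c) * φ) = fun y => c * φ y from rfl,
          fderiv_const_mul h1.differentiableAt]
        rfl }
    (fun f g => by
      obtain ⟨φ, hφ, rfl⟩ := exists_rep f
      obtain ⟨ψ, hψ, rfl⟩ := exists_rep g
      refine (toGerm_eq_iff (analyticAt_partial (hφ.mul hψ) i)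
        ((hφ.mul (analyticAt_partial hψ i)).add (hψ.mul (analyticAt_partial hφ i)))).2 ?_
      filter_upwards [hφ.eventually_analyticAt, hψ.eventually_analyticAt] with x h1 h2
      rw [fderiv_mul h1.differentiableAt h2.differentiableAt]
      rfl)

theorem evalZero_partialDer (i : Fin (n + 1)) (f : O n) :
    evalZero n (partialDer i f) = partialAtZero i f := by
  obtain ⟨φ, hφ, rfl⟩ := exists_rep f
  rfl

theorem partialDer_coord (i j : Fin (n + 1)) :
    partialDer i (coord j : O n) = if i = j then 1 else 0 := by
  have h : partialDer i (coord j : O n) =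
      toGerm (fun _ => (Pi.single i 1 : Fin (n + 1) → ℂ) j) analyticAt_const := by
    refine (toGerm_eq_iff (analyticAt_partial ((ContinuousLinearMap.proj j :
      (Fin (n + 1) → ℂ) →L[ℂ] ℂ).analyticAt 0) i) analyticAt_const).2
      (Eventually.of_forall fun x => ?_)
    rw [ContinuousLinearMap.fderiv]
    rfl
  rw [h]
  split_ifs with hij
  · subst hij; simp only [Pi.single_eq_same]; rfl
  · simp only [Pi.single_eq_of_ne (Ne.symm hij)]; rfl

/-- The Tjurina ideal `⟨f, ∂f/∂x₀, …, ∂f/∂xₙ⟩`. -/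
def tjurinaIdeal (f : O n) : Ideal (O n) :=
  Ideal.span {f} ⊔ Ideal.span (Set.range fun i => partialDer i f)

/-- The Nullstellensatz applied to `f` and its partials. All later use of isolatedness goes through
this inclusion. -/
theorem HasIsolatedSingularity.exists_pow_le {f : O n} (hf : HasIsolatedSingularity f) :
    ∃ k, maxIdeal n ^ k ≤ tjurinaIdeal f := by
  obtain ⟨φ, hφ, rfl, hiso⟩ := hf
  let g : Fin (n + 2) → analyticFunctions (Fin (n + 1) → ℂ) :=
    Fin.cons ⟨φ, hφ⟩ fun i => ⟨_, analyticAt_partial hφ i⟩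
  have hg : ∀ᶠ x in 𝓝 0, (∀ i, (g i).1 x = 0) → x = 0 := by
    filter_upwards [hiso] with x hx h
    refine hx.1 ⟨h 0, ?_⟩
    refine ContinuousLinearMap.coe_inj.1 (LinearMap.pi_ext' fun i => LinearMap.ext_ring ?_)
    exact h i.succ
  have hmap : germIdeal g ≤ (tjurinaIdeal (toGerm φ hφ)).comap (germHom n) := by
    refine sup_le (Ideal.span_le.2 ?_) ?_
    · rintro _ ⟨i, rfl⟩
      refine Fin.cases ?_ (fun i => ?_) i
      · exact Ideal.mem_sup_left (Ideal.subset_span rfl)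
      · exact Ideal.mem_sup_right (Ideal.subset_span ⟨i, rfl⟩)
    · intro ψ hψ
      have : germHom n ψ = 0 := (toGerm_eq_iff ψ.2 analyticAt_const).2 hψ
      rw [Ideal.mem_comap, this]
      exact zero_mem _
  refine Ideal.exists_pow_le_of_le_radical_of_fg ?_ maxIdeal_fg
  rw [maxIdeal_eq_span_coord, Ideal.span_le]
  rintro _ ⟨i, rfl⟩
  obtain ⟨k, hk⟩ := analytic_nullstellensatz (n + 1) (n + 2) g hg
    ⟨fun x => x i, (ContinuousLinearMap.proj i : (Fin (n + 1) → ℂ) →L[ℂ] ℂ).analyticAt 0⟩ rfl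
  refine ⟨k, ?_⟩
  have := hmap hk
  rwa [Ideal.mem_comap, map_pow] at this

end GermRing

/-! ### Taylor expansion and Tougeron's implicit function theorem. -/

section Taylor

open MvPolynomial

/-- Taylor expansion to first order with quadratic remainder. -/
theorem aeval_add_sub_mem_sq {ι B : Type*} [Fintype ι] [CommRing B] [Algebra ℂ B] (x h : ι → B)
    (p : MvPolynomial ι ℂ) :
    aeval (x + h) p - aeval x p - ∑ i, aeval x (pderiv i p) * h i ∈
      Ideal.span (Set.range h) ^ 2 := by
  classical
  set I := Ideal.span (Set.range h)
  have hh (i : ι) : h i ∈ I := Ideal.subset_span ⟨i, rfl⟩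
  induction p using MvPolynomial.induction_on with
  | C c => simp
  | add p q hp hq =>
    have := add_mem hp hq
    simp only [map_add, add_mul, Finset.sum_add_distrib]
    convert this using 1
    ring
  | mul_X p j hp =>
    set D := ∑ i, aeval x (pderiv i p) * h i with hD
    have hDI : D ∈ I := sum_mem fun i _ => Ideal.mul_mem_left _ _ (hh i)
    have h1 : ∑ i, aeval x (pderiv i (p * X j)) * h i = D * x j + aeval x p * h j := by
      simp only [Derivation.leibniz, pderiv_X, smul_eq_mul, map_add, map_mul, aeval_X, add_mul,
        Finset.sum_add_distrib]
      rw [add_comm, hD, Finset.sum_mul]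
      congr 1
      · exact Finset.sum_congr rfl fun i _ => by ring
      · rw [Finset.sum_eq_single j]
        · simp
        · intro i _ hij
          simp [hij.symm]
        · simp
    have h2 : D * h j ∈ I ^ 2 := by
      rw [pow_two]; exact Ideal.mul_mem_mul hDI (hh j)
    have h3 := add_mem (Ideal.mul_mem_right (x j + h j) _ hp) h2
    rw [h1, map_mul, map_mul, aeval_X, aeval_X, Pi.add_apply]
    convert h3 using 1
    ring

theorem span_range_sq {ι B : Type*} [CommRing B] (h : ι → B) :
    Ideal.span (Set.range h) ^ 2 = Ideal.span (Set.range fun ij : ι × ι => h ij.1 * h ij.2) := by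
  rw [pow_two, Ideal.span_mul_span']
  congr 1
  ext q
  simp [Set.mem_mul]

theorem analyticAt_eval {E ι : Type*} [NormedAddCommGroup E] [NormedSpace ℂ E] {x : E}
    {f : ι → E → ℂ} (hf : ∀ i, AnalyticAt ℂ (f i) x) (p : MvPolynomial ι ℂ) :
    AnalyticAt ℂ (fun v => eval (fun i => f i v) p) x := by
  induction p using MvPolynomial.induction_on with
  | C c => simpa only [eval_C] using analyticAt_const
  | add p q hp hq => simp only [map_add]; exact hp.add hq
  | mul_X p j hp => simp only [map_mul, eval_X]; exact hp.mul (hf j)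

/-- The expansion is made in the polynomial ring with indeterminates for both `Y` and `H`, so the
remainder coefficients are polynomials in them and stay analytic when analytic functions are
substituted. -/
theorem exists_taylor_remainder {ι : Type*} [Fintype ι] (p : MvPolynomial ι ℂ) :
    ∃ R : ι × ι → MvPolynomial (ι ⊕ ι) ℂ, ∀ Y H : ι → ℂ,
      eval (Y + H) p = eval Y p + ∑ i, eval Y (pderiv i p) * H i +
        ∑ i, ∑ j, H i * H j * eval (Sum.elim Y H) (R (i, j)) := by
  have h := aeval_add_sub_mem_sq (fun i : ι => (X (Sum.inl i) : MvPolynomial (ι ⊕ ι) ℂ))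
    (fun i => X (Sum.inr i)) p
  rw [span_range_sq] at h
  obtain ⟨R, hR⟩ := Ideal.mem_span_range_iff_exists_fun.1 h
  refine ⟨R, fun Y H => ?_⟩
  have h1 := congrArg (aeval (Sum.elim Y H)) hR
  simp only [map_sub, map_sum, map_mul, aeval_X, Fintype.sum_prod_type] at h1
  have h2 (q : MvPolynomial ι ℂ) (v : ι → MvPolynomial (ι ⊕ ι) ℂ) :
      aeval (Sum.elim Y H) (aeval v q) = eval (fun i => aeval (Sum.elim Y H) (v i)) q := by
    rw [← AlgHom.comp_apply, comp_aeval]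
    rfl
  simp only [h2, Pi.add_apply, map_add, aeval_X, Sum.elim_inl, Sum.elim_inr] at h1
  have h3 : (∑ i, ∑ j, H i * H j * eval (Sum.elim Y H) (R (i, j))) =
      ∑ i, ∑ j, aeval (Sum.elim Y H) (R (i, j)) * (H i * H j) :=
    Finset.sum_congr rfl fun i _ => Finset.sum_congr rfl fun j _ => mul_comm _ _
  rw [h3, h1]
  change eval (fun i => Y i + H i) p = _
  ring

theorem sum_comm₄ {ι M : Type*} [Fintype ι] [AddCommMonoid M] (f : ι → ι → ι → ι → M) :
    ∑ k, ∑ l, ∑ i, ∑ j, f k l i j = ∑ i, ∑ j, ∑ k, ∑ l, f k l i j := by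
  rw [Finset.sum_congr rfl fun k _ => Finset.sum_comm, Finset.sum_comm]
  refine Finset.sum_congr rfl fun i _ => ?_
  rw [Finset.sum_congr rfl fun k _ => Finset.sum_comm, Finset.sum_comm]

/-- A matrix equation `z + (quadratic terms in z) = a(x)` with `a 0 = 0` has an analytic solution
vanishing at the origin. -/
theorem exists_solution_quadratic {E : Type*} [NormedAddCommGroup E] [NormedSpace ℂ E]
    [CompleteSpace E] {ι : Type*} [Fintype ι] {r : E × (ι → ι → ℂ) → ι → ι → ℂ}
    (hr : ∀ i j, AnalyticAt ℂ (fun v => r v i j) 0)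
    {a : E → ι → ι → ℂ} (ha : AnalyticAt ℂ a 0) (ha0 : a 0 = 0) :
    ∃ z : E → ι → ι → ℂ, AnalyticAt ℂ z 0 ∧ z 0 = 0 ∧ ∀ᶠ x in 𝓝 0, ∀ k l,
      a x k l = z x k l + ∑ i, ∑ j, z x i k * z x j l * r (x, z x) i j := by
  have hz (i j : ι) : AnalyticAt ℂ (fun v : E × (ι → ι → ℂ) => v.2 i j) 0 :=
    ((ContinuousLinearMap.proj j : (ι → ℂ) →L[ℂ] ℂ) ∘L
      (ContinuousLinearMap.proj i : (ι → ι → ℂ) →L[ℂ] ι → ℂ) ∘L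
      ContinuousLinearMap.snd ℂ E (ι → ι → ℂ)).analyticAt 0
  have ha' (k l : ι) : AnalyticAt ℂ (fun x => a x k l) 0 :=
    ((ContinuousLinearMap.proj l : (ι → ℂ) →L[ℂ] ℂ) ∘L
      (ContinuousLinearMap.proj k : (ι → ι → ℂ) →L[ℂ] ι → ℂ)).analyticAt _ |>.fun_comp ha
  let Q (v : E × (ι → ι → ℂ)) (k l : ι) : ℂ := ∑ i, ∑ j, v.2 i k * v.2 j l * r v i j
  let Φ (v : E × (ι → ι → ℂ)) (k l : ι) : ℂ := v.2 k l + Q v k l - a v.1 k l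
  have hΦ : AnalyticAt ℂ Φ 0 := by
    refine AnalyticAt.pi fun k => AnalyticAt.pi fun l => ((hz k l).add ?_).sub
      (AnalyticAt.fun_comp (g := fun x => a x k l) (ha' k l) analyticAt_fst)
    exact Finset.analyticAt_fun_sum _ fun i _ => Finset.analyticAt_fun_sum _ fun j _ =>
      ((hz i k).mul (hz j l)).mul (hr i j)
  have hΦ0 : Φ 0 = 0 := by
    funext k l
    simp [Φ, Q, ha0]
  -- The quadratic terms do not contribute to the derivative at `z = 0`, so the partial derivative
  -- in `z` is the identity.
  have hder (b : ι → ι → ℂ) : fderiv ℂ Φ 0 (0, b) = b := by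
    let γ : ℂ → E × (ι → ι → ℂ) := fun t => (0, t • b)
    have hγ : HasDerivAt γ (0, b) 0 := by
      refine (hasDerivAt_const _ _).prodMk ?_
      simpa using (hasDerivAt_id (0 : ℂ)).smul_const b
    have hγ0 : γ 0 = 0 := by simp [γ]
    have d1 : HasDerivAt (Φ ∘ γ) (fderiv ℂ Φ 0 (0, b)) 0 := by
      have : HasFDerivAt Φ (fderiv ℂ Φ 0) (γ 0) := by
        rw [hγ0]; exact hΦ.differentiableAt.hasFDerivAt
      exact this.comp_hasDerivAt 0 hγ
    funext k l
    have d2 : HasDerivAt (fun t => Φ (γ t) k l) (fderiv ℂ Φ 0 (0, b) k l) 0 :=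
      hasDerivAt_pi.1 (hasDerivAt_pi.1 d1 k) l
    let s (t : ℂ) : ℂ := ∑ i, ∑ j, b i k * b j l * r (γ t) i j
    have hs : DifferentiableAt ℂ s 0 := by
      refine DifferentiableAt.fun_sum fun i _ => DifferentiableAt.fun_sum fun j _ =>
        DifferentiableAt.const_mul ?_ _
      have : DifferentiableAt ℂ (fun v => r v i j) (γ 0) := by
        rw [hγ0]; exact (hr i j).differentiableAt
      exact this.comp 0 hγ.differentiableAt
    have d3 : HasDerivAt (fun t => t * b k l + t * (t * s t) - a 0 k l) (b k l) 0 := by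
      have := (((hasDerivAt_id (0 : ℂ)).mul_const (b k l)).add ((hasDerivAt_id (0 : ℂ)).mul
        ((hasDerivAt_id (0 : ℂ)).mul hs.hasDerivAt))).sub_const (a 0 k l)
      simpa using this
    refine d2.unique (d3.congr_of_eventuallyEq (Eventually.of_forall fun t => ?_))
    simp only [Φ, Q, s, γ, Pi.smul_apply, smul_eq_mul, Finset.mul_sum]
    congr 2
    exact Finset.sum_congr rfl fun i _ => Finset.sum_congr rfl fun j _ => by ring
  obtain ⟨z, hz, hz0, hzΦ⟩ := exists_analytic_implicit hΦ hΦ0 fun b hb => by rw [← hder b, hb]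
  refine ⟨z, hz, hz0, ?_⟩
  filter_upwards [hzΦ] with x hx k l
  have := congrFun (congrFun hx k) l
  simp only [Φ, Q, Pi.zero_apply] at this
  linear_combination -this

/-- Tougeron's implicit function theorem for a polynomial: if `a` vanishes at the origin, then
`p(Y) + ∑ aₖₗ ∂ₖp(Y) ∂ₗp(Y)` is of the form `p(Y + z ∇p(Y))`. -/
theorem exists_tougeron {E : Type*} [NormedAddCommGroup E] [NormedSpace ℂ E] [CompleteSpace E]
    {ι : Type*} [Fintype ι] (p : MvPolynomial ι ℂ) {Y : E → ι → ℂ} (hY : AnalyticAt ℂ Y 0)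
    {a : E → ι → ι → ℂ} (ha : AnalyticAt ℂ a 0) (ha0 : a 0 = 0) :
    ∃ z : E → ι → ι → ℂ, AnalyticAt ℂ z 0 ∧ z 0 = 0 ∧ ∀ᶠ x in 𝓝 0,
      eval (fun i => Y x i + ∑ j, z x i j * eval (Y x) (pderiv j p)) p = eval (Y x) p +
        ∑ k, ∑ l, a x k l * (eval (Y x) (pderiv k p) * eval (Y x) (pderiv l p)) := by
  classical
  obtain ⟨R, hR⟩ := exists_taylor_remainder p
  have hYi (i : ι) : AnalyticAt ℂ (fun x => Y x i) 0 :=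
    (ContinuousLinearMap.proj i : (ι → ℂ) →L[ℂ] ℂ).analyticAt _ |>.fun_comp hY
  let P (x : E) (j : ι) : ℂ := eval (Y x) (pderiv j p)
  have hP (j : ι) : AnalyticAt ℂ (fun x => P x j) 0 := analyticAt_eval hYi _
  let H (v : E × (ι → ι → ℂ)) (i : ι) : ℂ := ∑ j, v.2 i j * P v.1 j
  have hz (i j : ι) : AnalyticAt ℂ (fun v : E × (ι → ι → ℂ) => v.2 i j) 0 :=
    ((ContinuousLinearMap.proj j : (ι → ℂ) →L[ℂ] ℂ) ∘L
      (ContinuousLinearMap.proj i : (ι → ι → ℂ) →L[ℂ] ι → ℂ) ∘L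
      ContinuousLinearMap.snd ℂ E (ι → ι → ℂ)).analyticAt 0
  have hH (i : ι) : AnalyticAt ℂ (fun v => H v i) 0 :=
    Finset.analyticAt_fun_sum _ fun j _ => (hz i j).mul
      (AnalyticAt.fun_comp (g := fun x => P x j) (hP j) analyticAt_fst)
  let r (v : E × (ι → ι → ℂ)) (i j : ι) : ℂ := eval (Sum.elim (Y v.1) (H v)) (R (i, j))
  have hs (s : ι ⊕ ι) : AnalyticAt ℂ (fun v => Sum.elim (Y v.1) (H v) s) 0 := by
    rcases s with i | i
    · exact AnalyticAt.fun_comp (g := fun x => Y x i) (hYi i) analyticAt_fst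
    · exact hH i
  have hr (i j : ι) : AnalyticAt ℂ (fun v => r v i j) 0 := analyticAt_eval hs (R (i, j))
  -- Substitute `H = z ∇p` into the Taylor formula and compare coefficients of `∂ₖp ∂ₗp`: the linear
  -- term gives `zₖₗ`, the remainder gives `∑ zᵢₖ zⱼₗ rᵢⱼ`.
  obtain ⟨z, hz, hz0, hza⟩ := exists_solution_quadratic hr ha ha0
  refine ⟨z, hz, hz0, ?_⟩
  filter_upwards [hza] with x h2
  have h1 := hR (Y x) (H (x, z x))
  change eval (Y x + H (x, z x)) p = eval (Y x) p + ∑ k, ∑ l, a x k l * (P x k * P x l)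
  rw [h1, add_assoc]
  congr 1
  simp only [h2, add_mul, Finset.sum_add_distrib]
  congr 1
  · refine Finset.sum_congr rfl fun k _ => ?_
    simp only [H, Finset.mul_sum]
    exact Finset.sum_congr rfl fun l _ => by simp only [P]; ring
  · simp only [Finset.sum_mul]
    rw [sum_comm₄]
    refine Finset.sum_congr rfl fun i _ => Finset.sum_congr rfl fun j _ => ?_
    simp only [H, Finset.sum_mul, Finset.mul_sum]
    rw [Finset.sum_comm]
    refine Finset.sum_congr rfl fun k _ => Finset.sum_congr rfl fun l _ => ?_
    simp only [r, H]
    ring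

end Taylor

/-! ### Absorbing an error in `𝔪 J²` by a change of coordinates. -/

section Coordinates

open MvPolynomial

variable {n : ℕ}

theorem aeval_toGerm {Y : Fin (n + 1) → (Fin (n + 1) → ℂ) → ℂ} (hY : ∀ i, AnalyticAt ℂ (Y i) 0)
    (p : MvPolynomial (Fin (n + 1)) ℂ) :
    aeval (fun i => toGerm (Y i) (hY i)) p =
      toGerm (fun x => eval (fun i => Y i x) p) (analyticAt_eval hY p) := by
  induction p using MvPolynomial.induction_on with
  | C c => simp only [aeval_C, algebraMap_eq_toGerm, eval_C]
  | add p q hp hq => 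
    simp only [map_add, hp, hq]
    rfl
  | mul_X p j hp =>
    simp only [map_mul, hp, aeval_X, eval_X]
    rfl

theorem partialAtZero_add (i : Fin (n + 1)) (f g : O n) :
    partialAtZero i (f + g) = partialAtZero i f + partialAtZero i g := by
  simp only [← evalZero_partialDer, map_add]

theorem partialAtZero_sum {κ : Type*} (i : Fin (n + 1)) (s : Finset κ) (f : κ → O n) :
    partialAtZero i (∑ j ∈ s, f j) = ∑ j ∈ s, partialAtZero i (f j) := by
  simp only [← evalZero_partialDer, map_sum]

theorem partialAtZero_mul (i : Fin (n + 1)) (f g : O n) :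
    partialAtZero i (f * g) = evalZero n f * partialAtZero i g + evalZero n g * partialAtZero i f := by
  simp only [← evalZero_partialDer, Derivation.leibniz, smul_eq_mul, map_add, map_mul]

/-- A germ congruent to `p(y)` modulo `𝔪 J²`, with `J` generated by the partial derivatives of `p`
at `y`, is of the form `p(y')` for another coordinate system `y'`. -/
theorem exists_coordinateSystem_of_sub_mem {y : Fin (n + 1) → O n} (hy : IsCoordinateSystem y)
    (p : MvPolynomial (Fin (n + 1)) ℂ) (hp : ∀ i, aeval y (pderiv i p) ∈ maxIdeal n) {F : O n}
    (hF : F - aeval y p ∈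
      maxIdeal n * Ideal.span (Set.range fun i => aeval y (pderiv i p)) ^ 2) :
    ∃ y' : Fin (n + 1) → O n, IsCoordinateSystem y' ∧ F = aeval y' p := by
  rw [span_range_sq, ← smul_eq_mul (a := maxIdeal n), Ideal.span,
    Submodule.mem_ideal_smul_span_iff_exists_sum] at hF
  obtain ⟨a, ha, hsum⟩ := hF
  rw [Finsupp.sum_fintype _ _ (by simp)] at hsum
  choose Y hY hYy using fun i => exists_rep (y i)
  choose A hA hAa using fun ij => exists_rep (a ij)
  have hy' : y = fun i => toGerm (Y i) (hY i) := funext fun i => (hYy i).symm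
  have hYa : AnalyticAt ℂ (fun x i => Y i x) 0 := AnalyticAt.pi hY
  obtain ⟨z, hz, hz0, hzY⟩ := exists_tougeron p hYa (a := fun x k l => A (k, l) x)
    (AnalyticAt.pi fun k => AnalyticAt.pi fun l => hA (k, l)) (by
      funext k l
      have := ha (k, l)
      rw [← hAa] at this
      exact this)
  have hzi (i j : Fin (n + 1)) : AnalyticAt ℂ (fun x => z x i j) 0 :=
    ((ContinuousLinearMap.proj j : (Fin (n + 1) → ℂ) →L[ℂ] ℂ) ∘L
      (ContinuousLinearMap.proj i : (Fin (n + 1) → Fin (n + 1) → ℂ) →L[ℂ] Fin (n + 1) → ℂ)).analyticAt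
        _ |>.fun_comp hz
  let y' (i : Fin (n + 1)) : O n := y i + ∑ j, toGerm _ (hzi i j) * aeval y (pderiv j p)
  have hzm (i j : Fin (n + 1)) : evalZero n (toGerm _ (hzi i j)) = 0 := by
    rw [evalZero_toGerm, hz0]; rfl
  refine ⟨y', ⟨fun i => add_mem (hy.1 i) (sum_mem fun j _ => Ideal.mul_mem_right _ _ (hzm i j)),
    ?_⟩, ?_⟩
  -- Each correction term is a product of two germs vanishing at `0`, so it has no linear part.
  · have : jacobianAtZero y' = jacobianAtZero y := by
      ext i j
      simp only [jacobianAtZero, Matrix.of_apply, y', partialAtZero_add, partialAtZero_sum,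
        partialAtZero_mul, hzm, mem_maxIdeal.1 (hp _), zero_mul, add_zero, Finset.sum_const_zero]
    rw [this]
    exact hy.2
  · let 𝒜 := analyticFunctions (Fin (n + 1) → ℂ)
    have hPan (j : Fin (n + 1)) : AnalyticAt ℂ (fun x => eval (fun i => Y i x) (pderiv j p)) 0 :=
      analyticAt_eval hY _
    let PA (j : Fin (n + 1)) : 𝒜 := ⟨_, hPan j⟩
    have hPA (j : Fin (n + 1)) : germHom n (PA j) = aeval y (pderiv j p) := by
      rw [hy', aeval_toGerm hY]; rfl
    let Y' (i : Fin (n + 1)) : 𝒜 := ⟨Y i, hY i⟩ + ∑ j, ⟨_, hzi i j⟩ * PA j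
    have hY' (i : Fin (n + 1)) : toGerm (Y' i).1 (Y' i).2 = y' i := by
      change germHom n (Y' i) = _
      simp only [Y', map_add, map_sum, map_mul, hPA, y', ← hYy i]
      rfl
    have hY'e (i : Fin (n + 1)) (x : Fin (n + 1) → ℂ) :
        (Y' i).1 x = Y i x + ∑ j, z x i j * eval (fun i => Y i x) (pderiv j p) := by
      change evalAt x (Y' i) = _
      simp only [Y', map_add, map_sum, map_mul]
      rfl
    let 𝒮 : 𝒜 := ⟨_, analyticAt_eval hY p⟩ +
      ∑ k, ∑ l, ⟨_, hA (k, l)⟩ * (PA k * PA l)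
    have h1 : toGerm 𝒮.1 𝒮.2 = F := by
      change germHom n 𝒮 = _
      rw [eq_add_of_sub_eq' hsum.symm, Fintype.sum_prod_type]
      simp only [𝒮, map_add, map_sum, map_mul, hPA, smul_eq_mul]
      rw [hy', aeval_toGerm hY]
      simp only [← hAa]
      rfl
    have h2 : aeval y' p = toGerm (fun x => eval (fun i => (Y' i).1 x) p)
        (analyticAt_eval (fun i => (Y' i).2) p) := by
      rw [← aeval_toGerm fun i => (Y' i).2]
      exact congrArg (fun v => aeval v p) (funext fun i => (hY' i).symm)
    rw [h2, ← h1]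
    refine (toGerm_eq_iff 𝒮.2 _).2 ?_
    filter_upwards [hzY] with x hx
    simp only [hY'e]
    refine Eq.trans ?_ hx.symm
    change evalAt x 𝒮 = _
    simp only [𝒮, map_add, map_sum, map_mul]
    rfl

end Coordinates

/-! ### Derivations and powers of ideals. -/

section Derivations

variable {R A : Type*} [CommRing R] [CommRing A] [Algebra R A]

theorem derivation_mem_pow (δ : Derivation R A A) (I : Ideal A) (N : ℕ) :
    ∀ x ∈ I ^ (N + 1), δ x ∈ I ^ N := by
  induction N with
  | zero => intro x _; simp
  | succ N ih =>
    intro x hx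
    rw [pow_succ] at hx
    refine Submodule.mul_induction_on hx (fun a ha b hb => ?_) fun a b ha hb => ?_
    · rw [Derivation.leibniz, smul_eq_mul, smul_eq_mul]
      refine add_mem (Ideal.mul_mem_right _ _ ha) ?_
      rw [pow_succ']
      exact Ideal.mul_mem_mul hb (ih a ha)
    · rw [map_add]; exact add_mem ha hb

theorem derivation_mem_pow_of_stable {δ : Derivation R A A} {I : Ideal A} (h : ∀ x ∈ I, δ x ∈ I)
    (N : ℕ) : ∀ x ∈ I ^ N, δ x ∈ I ^ N := by
  induction N with
  | zero => intro x _; simp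
  | succ N ih =>
    intro x hx
    rw [pow_succ] at hx ⊢
    refine Submodule.mul_induction_on hx (fun a ha b hb => ?_) fun a b ha hb => ?_
    · rw [Derivation.leibniz, smul_eq_mul, smul_eq_mul]
      refine add_mem (Ideal.mul_mem_mul ha (h b hb)) ?_
      rw [mul_comm b]
      exact Ideal.mul_mem_mul (ih a ha) hb
    · rw [map_add]; exact add_mem ha hb

theorem derivation_mem_of_span {δ : Derivation R A A} {S : Set A} {I : Ideal A}
    (hS : S ⊆ I) (h : ∀ x ∈ S, δ x ∈ I) : ∀ x ∈ Ideal.span S, δ x ∈ I := by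
  intro x hx
  refine (Submodule.span_induction (p := fun x _ => x ∈ I ∧ δ x ∈ I) (fun x hx => ⟨hS hx, h x hx⟩)
    ⟨I.zero_mem, by simp⟩ (fun x y _ _ hx hy => ⟨add_mem hx.1 hy.1, ?_⟩)
    (fun a x _ hx => ⟨I.mul_mem_left a hx.1, ?_⟩) hx).2
  · rw [map_add]; exact add_mem hx.2 hy.2
  · rw [smul_eq_mul, Derivation.leibniz, smul_eq_mul, smul_eq_mul]
    exact add_mem (I.mul_mem_left _ hx.2) (I.mul_mem_right _ hx.1)

theorem derivation_sum_apply {κ : Type*} (s : Finset κ) (D : κ → Derivation R A A) (x : A) :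
    (∑ i ∈ s, D i) x = ∑ i ∈ s, D i x := by
  classical
  induction s using Finset.induction_on with
  | empty => simp
  | insert i s hi ih => rw [Finset.sum_insert hi, Finset.sum_insert hi, Derivation.add_apply, ih]

end Derivations

/-! ### Logarithmic fields preserve the Tjurina ideal and vanish at the origin. -/

section LogarithmicDerivations

variable {n : ℕ}

/-- In characteristic zero `δ(h^(j+1)) = (j+1) h^j δ(h)` is a unit times `h^j`, so membership would
descend to `1 ∈ J 0`. The chain `J` is left free: it is used with powers of `𝔪`, with the constant
Tjurina ideal, and with `q ⊔ 𝔪^(j+1)`. -/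
theorem pow_notMem_of_isUnit_derivation {δ : Derivation ℂ (O n) (O n)} {J : ℕ → Ideal (O n)}
    (hJ : ∀ j, ∀ x ∈ J (j + 1), δ x ∈ J j) (h0 : J 0 ≤ maxIdeal n) {h : O n}
    (hu : IsUnit (δ h)) (j : ℕ) : h ^ j ∉ J j := by
  induction j with
  | zero => exact fun h => one_notMem_maxIdeal (h0 (by simpa using h))
  | succ j ih =>
    intro hj
    have := hJ j _ hj
    rw [Derivation.leibniz_pow, Nat.add_sub_cancel, smul_eq_mul, nsmul_eq_mul] at this
    have hc : IsUnit (((j + 1 : ℕ) : O n) * δ h) := by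
      refine IsUnit.mul (isUnit_iff_evalZero_ne_zero.2 ?_) hu
      rw [map_natCast]
      exact Nat.cast_ne_zero.2 (Nat.succ_ne_zero j)
    refine ih ((Ideal.mul_unit_mem_iff_mem _ hc).1 ?_)
    convert this using 1; ring

theorem maxIdeal_pow_not_le_succ (k : ℕ) : ¬ maxIdeal n ^ k ≤ maxIdeal n ^ (k + 1) := by
  intro h
  have hu : IsUnit (partialDer 0 (coord 0 : O n)) := by rw [partialDer_coord]; simp
  exact pow_notMem_of_isUnit_derivation (J := fun j => maxIdeal n ^ (j + 1))
    (fun j => derivation_mem_pow _ _ _) (by simp) hu k (h (Ideal.pow_mem_pow (coord_mem 0) k))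

/-- Lets `δ` be replaced by `∑ δ(xᵢ) ∂ᵢ` modulo any power of `𝔪`. Expanding `f - f(0)` in the
coordinates gains one power of `𝔪` at each step. -/
theorem derivation_mem_pow_of_coord_eq_zero {η : Derivation ℂ (O n) (O n)}
    (hη : ∀ i, η (coord i) = 0) (N : ℕ) (f : O n) : η f ∈ maxIdeal n ^ N := by
  induction N generalizing f with
  | zero => simp
  | succ N ih =>
    have hf := sub_algebraMap_mem f
    rw [maxIdeal_eq_span_coord, Ideal.mem_span_range_iff_exists_fun] at hf
    obtain ⟨c, hc⟩ := hf
    have : η f = ∑ i, coord i * η (c i) := by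
      rw [← sub_zero (η f), ← Derivation.map_algebraMap η (evalZero n f), ← map_sub, ← hc, map_sum]
      refine Finset.sum_congr rfl fun i _ => ?_
      rw [Derivation.leibniz, hη, smul_zero, zero_add, smul_eq_mul]
    rw [this, pow_succ']
    exact sum_mem fun i _ => Ideal.mul_mem_mul (coord_mem i) (ih _)

theorem self_mem_tjurinaIdeal (f : O n) : f ∈ tjurinaIdeal f :=
  Ideal.mem_sup_left (Ideal.mem_span_singleton_self f)

theorem partialDer_mem_tjurinaIdeal (i : Fin (n + 1)) (f : O n) :
    partialDer i f ∈ tjurinaIdeal f :=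
  Ideal.mem_sup_right (Ideal.subset_span ⟨i, rfl⟩)

theorem tjurinaIdeal_le {f : O n} {I : Ideal (O n)} (hf : f ∈ I) (h : ∀ i, partialDer i f ∈ I) :
    tjurinaIdeal f ≤ I := by
  refine sup_le ((Ideal.span_singleton_le_iff_mem _).2 hf) (Ideal.span_le.2 ?_)
  rintro _ ⟨i, rfl⟩
  exact h i

theorem partialDer_mem_tjurinaIdeal_of_mem {f g : O n} (i : Fin (n + 1))
    (h : g ∈ Ideal.span {f}) : partialDer i g ∈ tjurinaIdeal f := by
  obtain ⟨a, rfl⟩ := Ideal.mem_span_singleton'.1 h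
  rw [Derivation.leibniz, smul_eq_mul, smul_eq_mul]
  exact add_mem (Ideal.mul_mem_left _ _ (partialDer_mem_tjurinaIdeal i f))
    (Ideal.mul_mem_right _ _ (self_mem_tjurinaIdeal f))

theorem tjurinaIdeal_le_of_mem_span {f g : O n} (h : g ∈ Ideal.span {f}) :
    tjurinaIdeal g ≤ tjurinaIdeal f :=
  tjurinaIdeal_le (le_sup_left (a := Ideal.span {f}) h)
    fun i => partialDer_mem_tjurinaIdeal_of_mem i h

theorem tjurinaIdeal_le_pow {f : O n} {N : ℕ} (hf : f ∈ maxIdeal n ^ (N + 1)) :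
    tjurinaIdeal f ≤ maxIdeal n ^ N :=
  tjurinaIdeal_le (Ideal.pow_le_pow_right N.le_succ hf) fun _ => derivation_mem_pow _ _ _ _ hf

/-- Commute `δ` past `∂ⱼ`: `∂ⱼ(δ f)` is in the Tjurina ideal because `δ f ∈ 𝒪 f`, and `[δ, ∂ⱼ]`
agrees with `-∑ ∂ⱼ(δ xᵢ) ∂ᵢ` modulo `𝔪^k`, which `hk` places in the ideal. -/
theorem logDer_mem_tjurinaIdeal {f : O n} {k : ℕ} (hk : maxIdeal n ^ k ≤ tjurinaIdeal f)
    {δ : Derivation ℂ (O n) (O n)} (hδ : δ f ∈ Ideal.span {f}) :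
    ∀ x ∈ tjurinaIdeal f, δ x ∈ tjurinaIdeal f := by
  have hδ' : δ f ∈ tjurinaIdeal f := Ideal.mem_sup_left hδ
  have key (j : Fin (n + 1)) : δ (partialDer j f) ∈ tjurinaIdeal f := by
    let η : Derivation ℂ (O n) (O n) :=
      ⁅δ, partialDer j⁆ + ∑ i, partialDer j (δ (coord i)) • partialDer i
    have happ (g : O n) : η g = δ (partialDer j g) - partialDer j (δ g) +
        ∑ i, partialDer j (δ (coord i)) * partialDer i g := by
      simp [η, Derivation.commutator_apply, derivation_sum_apply]
    have hη (l : Fin (n + 1)) : η (coord l) = 0 := by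
      rw [happ, partialDer_coord]
      simp only [partialDer_coord, mul_ite, mul_one, mul_zero, Finset.sum_ite_eq',
        Finset.mem_univ, if_true]
      split_ifs <;> simp
    have h := hk (derivation_mem_pow_of_coord_eq_zero hη k f)
    rw [happ] at h
    have h2 := (Ideal.add_mem_iff_left _ (sum_mem fun i _ =>
      Ideal.mul_mem_left _ _ (partialDer_mem_tjurinaIdeal i f))).1 h
    simpa using add_mem h2 (partialDer_mem_tjurinaIdeal_of_mem j hδ)
  intro x hx
  obtain ⟨a, ha, b, hb, rfl⟩ := Submodule.mem_sup.1 hx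
  rw [map_add]
  refine add_mem (derivation_mem_of_span (Set.singleton_subset_iff.2 (self_mem_tjurinaIdeal f))
    (by rintro _ rfl; exact hδ') a ha) (derivation_mem_of_span ?_ ?_ b hb)
  · rintro _ ⟨i, rfl⟩; exact partialDer_mem_tjurinaIdeal i f
  · rintro _ ⟨i, rfl⟩; exact key i

/-- If `δ(xᵢ)` were a unit, applying `δ` repeatedly to `xᵢ^k` would put `1` in the Tjurina ideal,
which is proper since `f ∈ 𝔪²`. -/
theorem logDer_coord_mem {f : O n} (hf : f ∈ maxIdeal n ^ 2) {k : ℕ}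
    (hk : maxIdeal n ^ k ≤ tjurinaIdeal f) {δ : Derivation ℂ (O n) (O n)}
    (hδ : δ f ∈ Ideal.span {f}) (i : Fin (n + 1)) : δ (coord i) ∈ maxIdeal n := by
  by_contra hu
  refine pow_notMem_of_isUnit_derivation (J := fun _ => tjurinaIdeal f)
    (fun _ => logDer_mem_tjurinaIdeal hk hδ) ?_ (isUnit_of_notMem_maxIdeal hu) k
    (hk (Ideal.pow_mem_pow (coord_mem i) k))
  simpa using tjurinaIdeal_le_pow hf

theorem derivation_mem_maxIdeal {δ : Derivation ℂ (O n) (O n)}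
    (hδ : ∀ i, δ (coord i) ∈ maxIdeal n) : ∀ x ∈ maxIdeal n, δ x ∈ maxIdeal n := by
  intro x hx
  rw [maxIdeal_eq_span_coord] at hx
  refine derivation_mem_of_span ?_ ?_ x hx
  · rintro _ ⟨i, rfl⟩; exact coord_mem i
  · rintro _ ⟨i, rfl⟩; exact hδ i

end LogarithmicDerivations

/-! ### Generalized eigenspaces of a derivation of a finite-dimensional algebra. -/

section GeneralizedEigenspaces

/-- The generalized eigenspaces of a derivation. -/
def eigen {Q : Type*} [CommRing Q] [Algebra ℂ Q] (D : Derivation ℂ Q Q) (c : ℂ) : Submodule ℂ Q :=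
  Module.End.maxGenEigenspace (D : Module.End ℂ Q) c

variable {Q : Type*} [CommRing Q] [Algebra ℂ Q] {D : Derivation ℂ Q Q}

theorem mem_eigen {c : ℂ} {x : Q} :
    x ∈ eigen D c ↔ ∃ k : ℕ, (((D : Module.End ℂ Q) - c • (1 : Module.End ℂ Q)) ^ k) x = 0 :=
  Module.End.mem_maxGenEigenspace _ _ _

theorem one_mem_eigen : (1 : Q) ∈ eigen D 0 := mem_eigen.2 ⟨1, by simp⟩

/-- Leibniz reads `(D - (b+c))(xy) = (D-b)x · y + x · (D-c)y`; each application lowers one of the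
two exponents. -/
theorem pow_sub_smul_one_mul (b c : ℂ) (N : ℕ) : ∀ (k l : ℕ) (x y : Q), k + l = N →
    (((D : Module.End ℂ Q) - b • (1 : Module.End ℂ Q)) ^ k) x = 0 →
    (((D : Module.End ℂ Q) - c • (1 : Module.End ℂ Q)) ^ l) y = 0 →
    (((D : Module.End ℂ Q) - (b + c) • (1 : Module.End ℂ Q)) ^ N) (x * y) = 0 := by
  induction N with
  | zero =>
    intro k l x y hkl hx _
    obtain rfl : k = 0 := by omega
    simp at hx
    simp [hx]
  | succ N ih =>
    intro k l x y hkl hx hy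
    have hstep : ((D : Module.End ℂ Q) - (b + c) • (1 : Module.End ℂ Q)) (x * y) =
        ((D : Module.End ℂ Q) - b • (1 : Module.End ℂ Q)) x * y +
        x * ((D : Module.End ℂ Q) - c • (1 : Module.End ℂ Q)) y := by
      simp only [LinearMap.sub_apply, LinearMap.smul_apply, Module.End.one_apply,
        Derivation.coeFn_coe, Derivation.leibniz, smul_eq_mul]
      simp only [Algebra.smul_def (A := Q), map_add]
      ring_nf
    rcases k with _ | k
    · have : x = 0 := by simpa using hx
      simp [this]
    rcases l with _ | l
    · have : y = 0 := by simpa using hy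
      simp [this]
    rw [pow_succ, Module.End.mul_apply, hstep, map_add,
      ih k (l + 1) _ _ (by omega) (by rwa [pow_succ, Module.End.mul_apply] at hx) hy,
      ih (k + 1) l _ _ (by omega) hx (by rwa [pow_succ, Module.End.mul_apply] at hy), add_zero]

theorem mul_mem_eigen {b c : ℂ} {x y : Q} (hx : x ∈ eigen D b) (hy : y ∈ eigen D c) :
    x * y ∈ eigen D (b + c) := by
  obtain ⟨k, hk⟩ := mem_eigen.1 hx
  obtain ⟨l, hl⟩ := mem_eigen.1 hy
  exact mem_eigen.2 ⟨k + l, pow_sub_smul_one_mul b c _ k l x y rfl hk hl⟩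

theorem pow_mem_eigen {c : ℂ} {x : Q} (hx : x ∈ eigen D c) (k : ℕ) :
    x ^ k ∈ eigen D (k * c) := by
  induction k with
  | zero => simpa using one_mem_eigen
  | succ k ih =>
    rw [pow_succ]
    convert mul_mem_eigen ih hx using 2
    push_cast; ring

theorem prod_pow_mem_eigen {ι : Type*} (s : Finset ι) {c : ι → ℂ} {x : ι → Q}
    (hx : ∀ i, x i ∈ eigen D (c i)) (k : ι → ℕ) :
    ∏ i ∈ s, x i ^ k i ∈ eigen D (∑ i ∈ s, k i * c i) := by
  classical
  induction s using Finset.induction_on with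
  | empty => simpa using one_mem_eigen
  | insert i s hi ih =>
    rw [Finset.prod_insert hi, Finset.sum_insert hi]
    exact mul_mem_eigen (pow_mem_eigen (hx i) _) ih

theorem exists_sum_eigen [FiniteDimensional ℂ Q] {S : Submodule ℂ Q} (hS : ∀ x ∈ S, D x ∈ S)
    {x : Q} (hx : x ∈ S) :
    ∃ (s : Finset ℂ) (g : ℂ → Q), (∀ c, g c ∈ S ∧ g c ∈ eigen D c) ∧ ∑ c ∈ s, g c = x := by
  rw [Submodule.eq_iSup_inf_genEigenspace (f := (D : Module.End ℂ Q)) ⊤ hS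
    (Module.End.iSup_maxGenEigenspace_eq_top _), Submodule.mem_iSup_iff_exists_finsupp] at hx
  obtain ⟨g, hg, hgx⟩ := hx
  exact ⟨g.support, g, fun c => hg c, hgx⟩

/-- By independence of the generalized eigenspaces, the summands with eigenvalue different from `c`
add up to zero. -/
theorem sum_filter_eq_of_mem_eigen {κ : Type*} (s : Finset κ) {w : κ → ℂ} {z : κ → Q}
    (hz : ∀ a ∈ s, z a ∈ eigen D (w a)) {c : ℂ} (hc : ∑ a ∈ s, z a ∈ eigen D c) [DecidableEq ℂ] :
    ∑ a ∈ s with w a = c, z a = ∑ a ∈ s, z a := by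
  rw [← Finset.sum_filter_add_sum_filter_not s (fun a => w a = c), left_eq_add]
  refine Submodule.disjoint_def.1
    ((Module.End.independent_maxGenEigenspace (D : Module.End ℂ Q)) c) _ ?_ ?_
  · rw [← Finset.sum_filter_add_sum_filter_not s (fun a => w a = c)] at hc
    refine (Submodule.add_mem_iff_right (eigen D c) (sum_mem fun a ha => ?_)).1 hc
    rw [Finset.mem_filter] at ha
    exact ha.2 ▸ hz a ha.1
  · refine sum_mem fun a ha => ?_
    rw [Finset.mem_filter] at ha
    exact Submodule.mem_iSup_of_mem (w a) (Submodule.mem_iSup_of_mem ha.2 (hz a ha.1))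

theorem exists_derivation_of_surjective {A : Type*} [CommRing A] [Algebra ℂ A]
    {π : A →ₐ[ℂ] Q} (hπ : Function.Surjective π) (δ : Derivation ℂ A A)
    (hδ : ∀ x, π x = 0 → π (δ x) = 0) :
    ∃ D : Derivation ℂ Q Q, ∀ x, D (π x) = π (δ x) := by
  have hwd {x y : A} (h : π x = π y) : π (δ x) = π (δ y) := by
    rw [← sub_eq_zero, ← map_sub, ← map_sub]
    exact hδ _ (by rw [map_sub, h, sub_self])
  have hs := Function.surjInv_eq hπ
  refine ⟨Derivation.mk' { toFun := fun q => π (δ (Function.surjInv hπ q))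
                           map_add' := fun a b => ?_
                           map_smul' := fun c a => ?_ } fun a b => ?_, fun x => hwd (hs _)⟩
  · rw [← map_add, ← map_add]; exact hwd (by rw [hs, map_add, hs, hs])
  · rw [RingHom.id_apply, ← map_smul, ← Derivation.map_smul]; exact hwd (by rw [hs, map_smul, hs])
  · change π (δ (Function.surjInv hπ (a * b))) = a • π (δ (Function.surjInv hπ b)) +
      b • π (δ (Function.surjInv hπ a))
    rw [hwd (y := Function.surjInv hπ a * Function.surjInv hπ b) (by rw [hs, map_mul, hs, hs]),
      Derivation.leibniz, map_add, smul_eq_mul, smul_eq_mul, map_mul, map_mul, hs, hs]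
    rfl

/-- The eigencomponents of a jet from a `δ`-stable ideal lift back into that ideal. Applied to `⟨f⟩`
it keeps the components multiples of `f`; applied to `𝔪` it yields candidate coordinates. -/
theorem exists_sum_lift_mem_eigen [FiniteDimensional ℂ Q] {A : Type*} [CommRing A] [Algebra ℂ A]
    {π : A →ₐ[ℂ] Q} {δ : Derivation ℂ A A} (hD : ∀ x, D (π x) = π (δ x)) {I : Ideal A}
    (hI : ∀ x ∈ I, δ x ∈ I) {x : A} (hx : x ∈ I) : ∃ (s : Finset ℂ) (g : ℂ → A),
      (∀ c, g c ∈ I ∧ π (g c) ∈ eigen D c) ∧ π x = π (∑ c ∈ s, g c) := by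
  let S := (I.restrictScalars ℂ).map (π).toLinearMap
  have hS : ∀ q ∈ S, D q ∈ S := by
    rintro _ ⟨x, hx, rfl⟩
    exact ⟨δ x, hI x hx, (hD x).symm⟩
  have hxS : π x ∈ S := ⟨x, hx, rfl⟩
  obtain ⟨s, h, hh, hsum⟩ := exists_sum_eigen (D := D) (S := S) hS hxS
  choose g hgI hg using fun c => (hh c).1
  refine ⟨s, g, fun c => ⟨hgI c, ?_⟩, ?_⟩
  · have := (hh c).2
    rwa [← hg c] at this
  · rw [map_sum]
    exact hsum.symm.trans (Finset.sum_congr rfl fun c _ => (hg c).symm)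

end GeneralizedEigenspaces

/-! ### Truncated germs form a finite-dimensional space. -/

section Truncation

variable {n : ℕ}

theorem exists_fg_sub_mem_maxIdeal_pow (n N : ℕ) :
    ∃ F : Submodule ℂ (O n), F.FG ∧ ∀ g : O n, ∃ t ∈ F, g - t ∈ maxIdeal n ^ N := by
  induction N with
  | zero => exact ⟨⊥, Submodule.fg_bot, fun g => ⟨0, Submodule.zero_mem _, by simp⟩⟩
  | succ N ih =>
    obtain ⟨F, hF, h⟩ := ih
    refine ⟨Submodule.span ℂ {1} ⊔ ⨆ i, F.map (LinearMap.mulLeft ℂ (coord i)),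
      (Submodule.fg_span_singleton 1).sup (Submodule.fg_iSup _ fun i => hF.map _), fun g => ?_⟩
    have hg := sub_algebraMap_mem g
    rw [maxIdeal_eq_span_coord, Ideal.mem_span_range_iff_exists_fun] at hg
    obtain ⟨c, hc⟩ := hg
    choose t ht htc using fun i => h (c i)
    refine ⟨algebraMap ℂ (O n) (evalZero n g) + ∑ i, coord i * t i, add_mem ?_ (sum_mem fun i _ => ?_), ?_⟩
    · rw [Algebra.algebraMap_eq_smul_one]
      exact Submodule.mem_sup_left (Submodule.smul_mem _ _ (Submodule.mem_span_singleton_self 1))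
    · exact Submodule.mem_sup_right (Submodule.mem_iSup_of_mem i ⟨t i, ht i, rfl⟩)
    · rw [← sub_sub, ← hc, ← Finset.sum_sub_distrib, pow_succ]
      refine sum_mem fun i _ => ?_
      rw [mul_comm (coord i), ← sub_mul]
      exact Ideal.mul_mem_mul (htc i) (coord_mem i)

end Truncation

/-! ### The cotangent space and coordinate systems. -/

section Coordinates

variable {n : ℕ}

theorem partialAtZero_eq_zero_of_mem_sq {f : O n} (hf : f ∈ maxIdeal n ^ 2) (i : Fin (n + 1)) :
    partialAtZero i f = 0 := by
  rw [← evalZero_partialDer]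
  exact mem_maxIdeal.1 (by simpa using derivation_mem_pow (partialDer i) (maxIdeal n) 1 f hf)

theorem mem_sq_of_partialAtZero_eq_zero {f : O n} (hf : f ∈ maxIdeal n)
    (h : ∀ i, partialAtZero i f = 0) : f ∈ maxIdeal n ^ 2 := by
  have hf' := hf
  rw [maxIdeal_eq_span_coord, Ideal.mem_span_range_iff_exists_fun] at hf'
  obtain ⟨c, rfl⟩ := hf'
  rw [pow_two]
  refine sum_mem fun i _ => Ideal.mul_mem_mul ?_ (coord_mem i)
  have hi := h i
  have h0 (j : Fin (n + 1)) : evalZero n (coord j) = 0 := coord_mem j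
  simp only [partialAtZero_sum, partialAtZero_mul, h0, zero_mul, add_zero] at hi
  simp only [← evalZero_partialDer, partialDer_coord] at hi
  simpa [mem_maxIdeal, apply_ite (evalZero n)] using hi

/-- The value at the origin as an algebra homomorphism. -/
def evalZeroₐ (n : ℕ) : O n →ₐ[ℂ] ℂ := { evalZero n with commutes' := evalZero_algebraMap }

/-- The differential at the origin. -/
def differential (n : ℕ) : O n →ₗ[ℂ] Fin (n + 1) → ℂ :=
  LinearMap.pi fun j => (evalZeroₐ n).toLinearMap ∘ₗ (partialDer j : O n →ₗ[ℂ] O n)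

theorem differential_apply (f : O n) (j : Fin (n + 1)) :
    differential n f j = partialAtZero j f := evalZero_partialDer j f

theorem differential_eq_zero_of_mem_sq {f : O n} (hf : f ∈ maxIdeal n ^ 2) :
    differential n f = 0 :=
  funext fun j => (differential_apply f j).trans (partialAtZero_eq_zero_of_mem_sq hf j)

theorem differential_coord (i : Fin (n + 1)) : differential n (coord i) = Pi.single i 1 := by
  funext j
  rw [differential_apply, ← evalZero_partialDer, partialDer_coord, Pi.single_apply,
    apply_ite (evalZero n), map_one, map_zero]

/-- Nakayama: a constant combination of the `yᵢ` matches the differential of any `x ∈ 𝔪`, leaving an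
error in `𝔪²`. -/
theorem IsCoordinateSystem.span_eq {y : Fin (n + 1) → O n} (hy : IsCoordinateSystem y) :
    Ideal.span (Set.range y) = maxIdeal n := by
  refine le_antisymm (Ideal.span_le.2 (by rintro _ ⟨i, rfl⟩; exact hy.1 i)) ?_
  refine Submodule.le_of_le_smul_of_le_jacobson_bot maxIdeal_fg maxIdeal_le_jacobson_bot
    fun x hx => ?_
  let c := Matrix.vecMul (differential n x) (jacobianAtZero y)⁻¹
  have hc : Matrix.vecMul c (jacobianAtZero y) = differential n x := by
    rw [Matrix.vecMul_vecMul, Matrix.nonsing_inv_mul _ ((Matrix.isUnit_iff_isUnit_det _).1 hy.2),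
      Matrix.vecMul_one]
  have hs : ∑ i, c i • y i ∈ Ideal.span (Set.range y) := sum_mem fun i _ =>
    Submodule.smul_of_tower_mem _ _ (Ideal.subset_span ⟨i, rfl⟩)
  have hm : ∑ i, c i • y i ∈ maxIdeal n := sum_mem fun i _ =>
    Submodule.smul_of_tower_mem _ _ (hy.1 i)
  refine Submodule.mem_sup.2 ⟨_, hs, x - ∑ i, c i • y i, ?_, by ring⟩
  rw [smul_eq_mul, ← pow_two]
  refine mem_sq_of_partialAtZero_eq_zero (sub_mem hx hm) fun j => ?_
  rw [← differential_apply, map_sub, map_sum, Pi.sub_apply, ← hc, Finset.sum_apply, sub_eq_zero]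
  simp only [Matrix.vecMul, dotProduct]
  refine Finset.sum_congr rfl fun i _ => ?_
  rw [map_smul, Pi.smul_apply, differential_apply, smul_eq_mul]
  rfl

/-- The derivations `∂/∂yᵢ` for a coordinate system `y`. -/
theorem IsCoordinateSystem.exists_dual_derivation {y : Fin (n + 1) → O n}
    (hy : IsCoordinateSystem y) (i : Fin (n + 1)) :
    ∃ η : Derivation ℂ (O n) (O n), ∀ l, η (y l) = if l = i then 1 else 0 := by
  let M : Matrix (Fin (n + 1)) (Fin (n + 1)) (O n) := Matrix.of fun l j => partialDer j (y l)
  have hM : IsUnit M.det := by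
    rw [isUnit_iff_evalZero_ne_zero, RingHom.map_det]
    have : (evalZero n).mapMatrix M = jacobianAtZero y := by
      ext l j
      exact evalZero_partialDer j (y l)
    rw [this]
    exact ((Matrix.isUnit_iff_isUnit_det _).1 hy.2).ne_zero
  refine ⟨∑ j, M⁻¹ j i • partialDer j, fun l => ?_⟩
  rw [derivation_sum_apply]
  have := congrFun (congrFun (Matrix.mul_nonsing_inv M hM) l) i
  rw [Matrix.mul_apply, Matrix.one_apply] at this
  rw [← this]
  refine Finset.sum_congr rfl fun j _ => ?_
  rw [Derivation.smul_apply, smul_eq_mul, mul_comm]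
  rfl

theorem differential_derivation {δ : Derivation ℂ (O n) (O n)}
    (hδ : ∀ i, δ (coord i) ∈ maxIdeal n) (g : O n) :
    differential n (δ g) =
      Matrix.vecMul (differential n g) (jacobianAtZero fun i => δ (coord i)) := by
  let η : Derivation ℂ (O n) (O n) := δ - ∑ i, δ (coord i) • partialDer i
  have hη (g : O n) : η g = δ g - ∑ i, δ (coord i) * partialDer i g := by
    simp [η, derivation_sum_apply]
  have h0 : η g ∈ maxIdeal n ^ 2 := derivation_mem_pow_of_coord_eq_zero (fun l => by
    simp [hη, partialDer_coord]) 2 g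
  have h := differential_eq_zero_of_mem_sq h0
  rw [hη, map_sub, sub_eq_zero] at h
  rw [h]
  funext j
  rw [differential_apply, partialAtZero_sum]
  refine Finset.sum_congr rfl fun i _ => ?_
  have hi : evalZero n (δ (coord i)) = 0 := hδ i
  rw [partialAtZero_mul, hi, zero_mul, zero_add, evalZero_partialDer, differential_apply]
  rfl

theorem differential_iterate {δ : Derivation ℂ (O n) (O n)}
    (hδ : ∀ i, δ (coord i) ∈ maxIdeal n) (g : O n) (K : ℕ) :
    differential n (δ^[K] g) =
      Matrix.vecMul (differential n g) ((jacobianAtZero fun i => δ (coord i)) ^ K) := by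
  induction K with
  | zero => simp
  | succ K ih =>
    rw [Function.iterate_succ_apply', differential_derivation hδ, ih, Matrix.vecMul_vecMul,
      pow_succ]

end Coordinates

/-! ### The action of `δ` on jets and its eigenvectors. -/

section Jets

variable {n : ℕ}

variable {Q : Type*} [CommRing Q] [Algebra ℂ Q] {π : O n →ₐ[ℂ] Q} {N : ℕ}
  {D : Derivation ℂ Q Q}

theorem finiteDimensional_of_surjective (hπ : Function.Surjective π)
    (hN : ∀ f, π f = 0 ↔ f ∈ maxIdeal n ^ N) : FiniteDimensional ℂ Q := by
  obtain ⟨F, hF, h⟩ := exists_fg_sub_mem_maxIdeal_pow n N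
  have htop : F.map π.toLinearMap = ⊤ := by
    refine Submodule.eq_top_iff'.2 fun q => ?_
    obtain ⟨g, rfl⟩ := hπ q
    obtain ⟨t, ht, hgt⟩ := h g
    refine ⟨t, ht, ?_⟩
    rw [← hN, map_sub, sub_eq_zero] at hgt
    exact hgt.symm
  exact Module.finite_def.2 (htop ▸ hF.map _)

theorem exists_quotient_algebra {A : Type} [CommRing A] [Algebra ℂ A] (I : Ideal A) :
    ∃ (Q : Type) (_ : CommRing Q) (_ : Algebra ℂ Q) (π : A →ₐ[ℂ] Q),
      Function.Surjective π ∧ ∀ f, π f = 0 ↔ f ∈ I :=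
  ⟨A ⧸ I, inferInstance, inferInstance, Ideal.Quotient.mkₐ ℂ I, Ideal.Quotient.mk_surjective,
    fun _ => Ideal.Quotient.eq_zero_iff_mem⟩

theorem exists_jet_derivation (hπ : Function.Surjective π)
    (hN : ∀ f, π f = 0 ↔ f ∈ maxIdeal n ^ N) {δ : Derivation ℂ (O n) (O n)}
    (hδ : ∀ i, δ (coord i) ∈ maxIdeal n) :
    ∃ D : Derivation ℂ Q Q, ∀ x, D (π x) = π (δ x) :=
  exists_derivation_of_surjective hπ δ fun x hx =>
    (hN _).2 (derivation_mem_pow_of_stable (derivation_mem_maxIdeal hδ) N x ((hN _).1 hx))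

/-- The jet of `f` is a sum of eigenvectors `g_c f`. If no `g_c` were a unit, `1 - ∑ g_c` would be
one, and `(1 - ∑ g_c) f ∈ 𝔪^N` would force `f ∈ 𝔪^N`. -/
theorem exists_unit_mul_mem_eigen [FiniteDimensional ℂ Q]
    (hN : ∀ f, π f = 0 ↔ f ∈ maxIdeal n ^ N) {δ : Derivation ℂ (O n) (O n)}
    (hD : ∀ x, D (π x) = π (δ x)) {f : O n} (hδ : δ f ∈ Ideal.span {f})
    (hf : f ∉ maxIdeal n ^ N) : ∃ (u : (O n)ˣ) (c : ℂ), π (u * f) ∈ eigen D c := by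
  obtain ⟨s, h, hh, hsum⟩ := exists_sum_lift_mem_eigen hD (I := Ideal.span {f})
    (derivation_mem_of_span (Set.singleton_subset_iff.2 (Ideal.mem_span_singleton_self f))
      (by rintro _ rfl; exact hδ)) (Ideal.mem_span_singleton_self f)
  choose g hg using fun c => Ideal.mem_span_singleton'.1 (hh c).1
  by_cases hu : ∃ c, IsUnit (g c)
  · obtain ⟨c, u, hu⟩ := hu
    exact ⟨u, c, hu ▸ hg c ▸ (hh c).2⟩
  · push Not at hu
    have h1 : IsUnit (1 - ∑ c ∈ s, g c) := by
      rw [isUnit_iff_evalZero_ne_zero, map_sub, map_one, map_sum, Finset.sum_eq_zero fun c _ => ?_]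
      · simp
      · by_contra h
        exact hu c (isUnit_iff_evalZero_ne_zero.2 h)
    refine absurd ((Ideal.unit_mul_mem_iff_mem _ h1).1 ((hN _).1 ?_)) hf
    rw [sub_mul, one_mul, Finset.sum_mul, map_sub, Finset.sum_congr rfl fun c _ => hg c, hsum,
      sub_self]

/-- Since `N ≥ 2`, jets determine differentials, so the differentials of germs in `𝔪` with
eigenvector jets span the cotangent space; a basis extracted from them gives the coordinates. -/
theorem exists_coordinateSystem_eigen [FiniteDimensional ℂ Q]
    (hN : ∀ f, π f = 0 ↔ f ∈ maxIdeal n ^ N) {δ : Derivation ℂ (O n) (O n)}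
    (hδ : ∀ i, δ (coord i) ∈ maxIdeal n) (hN2 : 2 ≤ N) (hD : ∀ x, D (π x) = π (δ x)) :
    ∃ (y : Fin (n + 1) → O n) (l : Fin (n + 1) → ℂ), IsCoordinateSystem y ∧
      ∀ i, π (y i) ∈ eigen D (l i) := by
  let Y : Set (O n) := {y | y ∈ maxIdeal n ∧ ∃ c, π y ∈ eigen D c}
  have hspan : Submodule.span ℂ (differential n '' Y) = ⊤ := by
    rw [eq_top_iff, ← (Pi.basisFun ℂ (Fin (n + 1))).span_eq, Submodule.span_le]
    rintro _ ⟨i, rfl⟩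
    rw [Pi.basisFun_apply, ← differential_coord]
    obtain ⟨s, g, hg, hsum⟩ := exists_sum_lift_mem_eigen hD (derivation_mem_maxIdeal hδ) (coord_mem i)
    have hsub : differential n (coord i - ∑ c ∈ s, g c) = 0 :=
      differential_eq_zero_of_mem_sq (Ideal.pow_le_pow_right hN2 ((hN _).1 (by rw [map_sub, hsum, sub_self])))
    rw [map_sub, sub_eq_zero, map_sum] at hsub
    rw [hsub]
    exact sum_mem fun c _ => Submodule.subset_span ⟨g c, ⟨(hg c).1, c, (hg c).2⟩, rfl⟩
  obtain ⟨b, hb, hbs, hli⟩ := exists_linearIndependent ℂ (differential n '' Y)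
  let B : Module.Basis b ℂ (Fin (n + 1) → ℂ) := .mk hli (by rw [Subtype.range_coe, hbs, hspan])
  let e := (B.indexEquiv (Pi.basisFun ℂ (Fin (n + 1)))).symm
  choose y hy hyb using fun i => hb (e i).2
  choose l hl using fun i => (hy i).2
  refine ⟨y, l, ⟨fun i => (hy i).1, ?_⟩, hl⟩
  rw [← Matrix.linearIndependent_rows_iff_isUnit]
  have hrow : (jacobianAtZero y).row = Subtype.val ∘ e := by
    funext i j
    rw [Function.comp_apply, ← hyb, differential_apply]
    rfl
  rw [hrow]
  exact hli.comp e e.injective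

/-- Some power `δ^K` sends every `yᵢ` into `𝔪²`. On differentials this says that the invertible
Jacobian of `y` times the `K`-th power of the linear part is zero. -/
theorem isNilpotent_jacobianAtZero_of_mem_eigen_zero
    (hN : ∀ f, π f = 0 ↔ f ∈ maxIdeal n ^ N) {δ : Derivation ℂ (O n) (O n)}
    (hδ : ∀ i, δ (coord i) ∈ maxIdeal n) (hN2 : 2 ≤ N) (hD : ∀ x, D (π x) = π (δ x))
    {y : Fin (n + 1) → O n} (hy : IsCoordinateSystem y) (h : ∀ i, π (y i) ∈ eigen D 0) :
    IsNilpotent (jacobianAtZero fun i => δ (coord i)) := by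
  choose k hk using fun i => mem_eigen.1 (h i)
  simp only [zero_smul, sub_zero] at hk
  let K := Finset.univ.sup k
  have hiter (j : ℕ) (x : O n) : ((D : Module.End ℂ (Q)) ^ j) (π x) =
      π (δ^[j] x) := by
    induction j with
    | zero => rfl
    | succ j ih =>
      rw [pow_succ', Module.End.mul_apply, ih, Function.iterate_succ_apply', ← hD]
      rfl
  refine ⟨K, (hy.2.mul_right_eq_zero).1 ?_⟩
  ext i j
  have hK : δ^[K] (y i) ∈ maxIdeal n ^ 2 := by
    refine Ideal.pow_le_pow_right hN2 ((hN _).1 ?_)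
    have hle : k i ≤ K := Finset.le_sup (Finset.mem_univ i)
    rw [← hiter, ← Nat.sub_add_cancel hle, pow_add,
      Module.End.mul_apply, hk, map_zero]
  have := congrFun (differential_iterate hδ (y i) K) j
  rw [differential_eq_zero_of_mem_sq hK] at this
  rw [Matrix.zero_apply, Matrix.mul_apply]
  refine Eq.trans ?_ this.symm
  simp only [Matrix.vecMul, dotProduct]
  refine Finset.sum_congr rfl fun r _ => ?_
  rw [differential_apply]
  rfl

end Jets

/-! ### From eigenvalue relations to positive integer weights. -/

section WeightArithmetic

variable {ι : Type*} [Fintype ι]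

/-- Such a monomial is `yᵢ^(a+1)` (then `j = i`) or `yᵢ^a yⱼ`; total degree at least `3` is what
gives `a ≥ 2`. -/
theorem exists_sum_mul_eq_mul_add [DecidableEq ι] (i : ι) (α : ι → ℕ)
    (h1 : ∑ l ∈ Finset.univ.erase i, α l ≤ 1) (h3 : 3 ≤ ∑ l, α l) :
    ∃ a : ℕ, 2 ≤ a ∧ ∃ j, ∀ l : ι → ℂ, ∑ t, α t * l t = a * l i + l j := by
  rw [← Finset.add_sum_erase _ _ (Finset.mem_univ i)] at h3
  have hsplit (l : ι → ℂ) : ∑ t, α t * l t = α i * l i + ∑ t ∈ Finset.univ.erase i, α t * l t :=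
    (Finset.add_sum_erase _ (fun t => (α t : ℂ) * l t) (Finset.mem_univ i)).symm
  rcases Nat.le_one_iff_eq_zero_or_eq_one.1 h1 with h | h
  · refine ⟨α i - 1, by omega, i, fun l => ?_⟩
    rw [hsplit, Finset.sum_eq_zero, Nat.cast_sub (by omega)]
    · push_cast; ring
    · intro t ht
      rw [Finset.sum_eq_zero_iff.1 h t ht, Nat.cast_zero, zero_mul]
  · refine ⟨α i, by omega, ?_⟩
    obtain ⟨j, hj, hα⟩ : ∃ j ∈ Finset.univ.erase i, 0 < α j := by
      by_contra! hc
      rw [Finset.sum_eq_zero fun t ht => Nat.le_zero.1 (hc t ht)] at h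
      exact zero_ne_one h
    rw [← Finset.add_sum_erase _ _ hj] at h
    have h0 : ∑ t ∈ (Finset.univ.erase i).erase j, α t = 0 := by omega
    refine ⟨j, fun l => ?_⟩
    rw [hsplit, ← Finset.add_sum_erase _ _ hj, Finset.sum_eq_zero, show α j = 1 by omega]
    · push_cast; ring
    · intro t ht
      rw [Finset.sum_eq_zero_iff.1 h0 t ht, Nat.cast_zero, zero_mul]

/-- For `‖lᵢ‖` maximal, `2‖lᵢ‖ ≤ a‖lᵢ‖ = ‖lⱼ‖ ≤ ‖lᵢ‖`. -/
theorem eq_zero_of_mul_add_eq_zero {l : ι → ℂ}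
    (h : ∀ i, ∃ a : ℕ, 2 ≤ a ∧ ∃ j, a * l i + l j = 0) : l = 0 := by
  funext i₀
  obtain ⟨i, -, hi⟩ := Finset.exists_max_image Finset.univ (fun i => ‖l i‖) ⟨i₀, Finset.mem_univ _⟩
  obtain ⟨a, ha, j, hj⟩ := h i
  have h1 : (a : ℝ) * ‖l i‖ = ‖l j‖ := by
    rw [← norm_neg (l j), ← eq_neg_of_add_eq_zero_left hj, norm_mul, Complex.norm_natCast]
  have h2 := hi j (Finset.mem_univ j)
  have h3 := hi i₀ (Finset.mem_univ i₀)
  have ha' : (2 : ℝ) ≤ a := by exact_mod_cast ha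
  have : ‖l i₀‖ ≤ 0 := by nlinarith [norm_nonneg (l i)]
  exact norm_le_zero_iff.1 this

/-- Let `M` and `m` be the extreme weights and suppose `m ≤ 0`. The relation at the minimum gives `M
≥ 1 - 2m ≥ 1`, the one at the maximum `m ≤ 1 - 2M`; together they give `M ≤ 1/3`. -/
theorem pos_of_mul_add_eq_one {w : ι → ℚ}
    (h : ∀ i, ∃ a : ℕ, 2 ≤ a ∧ ∃ j, a * w i + w j = 1) (i₀ : ι) : 0 < w i₀ := by
  obtain ⟨i, -, hi⟩ := Finset.exists_max_image Finset.univ w ⟨i₀, Finset.mem_univ _⟩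
  by_contra! h0
  obtain ⟨i', -, hi'⟩ := Finset.exists_min_image Finset.univ w ⟨i₀, Finset.mem_univ _⟩
  obtain ⟨a, ha, j, hj⟩ := h i
  obtain ⟨b, hb, j', hj'⟩ := h i'
  have h1 := hi' i₀ (Finset.mem_univ _)
  have h2 := hi j' (Finset.mem_univ _)
  have h3 := hi' j (Finset.mem_univ _)
  have ha' : (2 : ℚ) ≤ a := by exact_mod_cast ha
  have hb' : (2 : ℚ) ≤ b := by exact_mod_cast hb
  have h4 : 1 - 2 * w i' ≤ w i := by nlinarith
  have h5 : w i' ≤ 1 - 2 * w i := by nlinarith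
  linarith

theorem exists_common_denominator {w : ι → ℚ} (hw : ∀ i, 0 < w i) :
    ∃ d : ℕ, d ≠ 0 ∧ ∃ W : ι → ℕ, ∀ i, (W i : ℚ) = d * w i := by
  refine ⟨∏ i, (w i).den, Finset.prod_ne_zero_iff.2 fun i _ => (w i).den_ne_zero, ?_⟩
  refine ⟨fun i => (w i).num.toNat * ((∏ i, (w i).den) / (w i).den), fun i => ?_⟩
  obtain ⟨e, he⟩ := Finset.dvd_prod_of_mem (fun i => (w i).den) (Finset.mem_univ i)
  change (((w i).num.toNat * ((∏ i, (w i).den) / (w i).den) : ℕ) : ℚ) = _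
  rw [he, Nat.mul_div_cancel_left _ (w i).den_pos]
  have hn : ((w i).num.toNat : ℚ) = w i * (w i).den := by
    rw [Rat.mul_den_eq_num]
    exact_mod_cast Int.toNat_of_nonneg (Rat.num_pos.2 (hw i)).le
  push_cast
  rw [hn]; ring

/-- Here `c ≠ 0`, so some `ℚ`-linear `φ : ℂ → ℚ` has `φ c = 1`. It preserves relations with natural
coefficients, so the `φ(lᵢ)` are positive rational weights of degree `1`; clearing denominators
gives `W`, with `r` the common denominator. -/
theorem exists_weights {l : ι → ℂ} (hl : l ≠ 0) {c : ℂ}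
    (h : ∀ i, ∃ a : ℕ, 2 ≤ a ∧ ∃ j, a * l i + l j = c) :
    ∃ (W : ι → ℕ) (r : ℕ), (∀ i, 0 < W i) ∧ r ≠ 0 ∧
      ∀ α : ι → ℕ, ∑ i, α i * l i = c → ∑ i, α i * W i = r := by
  have hc : c ≠ 0 := by
    rintro rfl
    exact hl (eq_zero_of_mul_add_eq_zero h)
  obtain ⟨φ, hφ⟩ := Module.Projective.exists_dual_eq_one ℚ hc
  have hmul (a : ℕ) (z : ℂ) : φ (a * z) = a * φ z := by
    rw [← nsmul_eq_mul, map_nsmul, nsmul_eq_mul]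
  have hw : ∀ i, 0 < φ (l i) := pos_of_mul_add_eq_one fun i => by
    obtain ⟨a, ha, j, hj⟩ := h i
    exact ⟨a, ha, j, by rw [← hmul, ← map_add, hj, hφ]⟩
  obtain ⟨d, hd, W, hW⟩ := exists_common_denominator hw
  refine ⟨W, d, fun i => ?_, hd, fun α hα => ?_⟩
  · have : (0 : ℚ) < W i := by
      rw [hW]
      exact mul_pos (by exact_mod_cast Nat.pos_of_ne_zero hd) (hw i)
    exact_mod_cast this
  · have h1 := congrArg φ hα
    rw [map_sum, hφ] at h1
    have : ((∑ i, α i * W i : ℕ) : ℚ) = d := by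
      rw [← mul_one (d : ℚ), ← h1, Finset.mul_sum]
      push_cast
      refine Finset.sum_congr rfl fun i _ => ?_
      rw [hW, hmul]; ring
    exact_mod_cast this

end WeightArithmetic

/-! ### Approximating germs by polynomials in the coordinates. -/

section PolynomialApproximation

open MvPolynomial

variable {n : ℕ}

theorem aeval_eq_sum_prod (y : Fin (n + 1) → O n) (P : MvPolynomial (Fin (n + 1)) ℂ) :
    aeval y P = ∑ α ∈ P.support, P.coeff α • ∏ i, y i ^ α i := by
  rw [aeval_def, eval₂_eq']
  exact Finset.sum_congr rfl fun α _ => (Algebra.smul_def _ _).symm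

theorem derivation_aeval (δ : Derivation ℂ (O n) (O n)) (y : Fin (n + 1) → O n)
    (P : MvPolynomial (Fin (n + 1)) ℂ) :
    δ (aeval y P) = ∑ i, aeval y (pderiv i P) * δ (y i) := by
  induction P using MvPolynomial.induction_on with
  | C c => simp
  | add p q hp hq => simp [hp, hq, add_mul, Finset.sum_add_distrib]
  | mul_X p j hp =>
    simp only [map_mul, aeval_X, Derivation.leibniz, hp, smul_eq_mul, map_add, add_mul,
      Finset.sum_add_distrib, Finset.mul_sum]
    congr 1
    · rw [Finset.sum_eq_single j]
      · rw [pderiv_X_self, map_one, mul_one]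
      · intro i _ hij
        rw [pderiv_X_of_ne hij.symm, map_zero, mul_zero, zero_mul]
      · simp
    · exact Finset.sum_congr rfl fun i _ => by ring

theorem exists_aeval_sub_mem {y : Fin (n + 1) → O n} (hy : Ideal.span (Set.range y) = maxIdeal n)
    (N : ℕ) (g : O n) : ∃ P : MvPolynomial (Fin (n + 1)) ℂ, g - aeval y P ∈ maxIdeal n ^ N := by
  induction N generalizing g with
  | zero => exact ⟨0, by simp⟩
  | succ N ih =>
    have hg := sub_algebraMap_mem g
    rw [← hy, Ideal.mem_span_range_iff_exists_fun] at hg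
    obtain ⟨c, hc⟩ := hg
    choose P hP using fun i => ih (c i)
    refine ⟨C (evalZero n g) + ∑ i, P i * X i, ?_⟩
    simp only [map_add, map_sum, map_mul, aeval_X, aeval_C]
    rw [← sub_sub, ← hc, ← Finset.sum_sub_distrib, pow_succ]
    refine sum_mem fun i _ => ?_
    rw [← sub_mul]
    exact Ideal.mul_mem_mul (hP i) (hy ▸ Ideal.subset_span ⟨i, rfl⟩)

theorem exists_idealOfVars_aeval_sub_mem {y : Fin (n + 1) → O n}
    (hy : Ideal.span (Set.range y) = maxIdeal n) (N j : ℕ) : ∀ g ∈ maxIdeal n ^ j,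
      ∃ P ∈ idealOfVars (Fin (n + 1)) ℂ ^ j, g - aeval y P ∈ maxIdeal n ^ N := by
  induction j with
  | zero =>
    intro g _
    obtain ⟨P, hP⟩ := exists_aeval_sub_mem hy N g
    exact ⟨P, by simp, hP⟩
  | succ j ih =>
    intro g hg
    rw [pow_succ] at hg
    refine Submodule.mul_induction_on hg (fun a ha b hb => ?_) fun a b ha hb => ?_
    · obtain ⟨P, hP, haP⟩ := ih a ha
      rw [← hy, Ideal.mem_span_range_iff_exists_fun] at hb
      obtain ⟨c, rfl⟩ := hb
      choose Q hQ using fun i => exists_aeval_sub_mem hy N (c i)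
      refine ⟨P * ∑ i, Q i * X i, ?_, ?_⟩
      · rw [pow_succ]
        exact Ideal.mul_mem_mul hP (sum_mem fun i _ =>
          Ideal.mul_mem_left _ _ (Ideal.subset_span ⟨i, rfl⟩))
      · have : a * ∑ i, c i * y i - aeval y (P * ∑ i, Q i * X i) =
            (a - aeval y P) * ∑ i, c i * y i + aeval y P * ∑ i, (c i - aeval y (Q i)) * y i := by
          simp only [map_mul, map_sum, aeval_X, sub_mul, Finset.sum_sub_distrib, mul_sub]
          ring
        rw [this]
        exact add_mem (Ideal.mul_mem_right _ _ haP) (Ideal.mul_mem_left _ _ (sum_mem fun i _ =>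
          Ideal.mul_mem_right _ _ (hQ i)))
    · obtain ⟨P, hP, haP⟩ := ha
      obtain ⟨Q, hQ, hbQ⟩ := hb
      refine ⟨P + Q, add_mem hP hQ, ?_⟩
      rw [map_add, add_sub_add_comm]
      exact add_mem haP hbQ

/-- The jet of `y^α` has eigenvalue `∑ αᵢ lᵢ`, so the monomials of any polynomial approximation
whose eigenvalue differs from `c` can be dropped; this also preserves the lower bound `j` on
degrees. -/
theorem exists_aeval_sub_mem_of_mem_eigen {Q : Type*} [CommRing Q] [Algebra ℂ Q]
    {π : O n →ₐ[ℂ] Q} {N : ℕ} (hN : ∀ f, π f = 0 ↔ f ∈ maxIdeal n ^ N) {D : Derivation ℂ Q Q} {y : Fin (n + 1) → O n}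
    (hy : Ideal.span (Set.range y) = maxIdeal n) {l : Fin (n + 1) → ℂ}
    (hl : ∀ i, π (y i) ∈ eigen D (l i)) {j : ℕ} {g : O n} (hg : g ∈ maxIdeal n ^ j) {c : ℂ}
    (hc : π g ∈ eigen D c) : ∃ P ∈ idealOfVars (Fin (n + 1)) ℂ ^ j,
      (∀ α ∈ P.support, ∑ i, (α i : ℂ) * l i = c) ∧ g - aeval y P ∈ maxIdeal n ^ N := by
  classical
  obtain ⟨P, hP, hgP⟩ := exists_idealOfVars_aeval_sub_mem hy N j g hg
  let w : (Fin (n + 1) →₀ ℕ) → ℂ := fun α => ∑ i, (α i : ℂ) * l i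
  let z : (Fin (n + 1) →₀ ℕ) → Q := fun α => π (P.coeff α • ∏ i, y i ^ α i)
  have hz (α) : z α ∈ eigen D (w α) := by
    simp only [z, map_smul, map_prod, map_pow]
    exact Submodule.smul_mem _ _ (prod_pow_mem_eigen _ hl α)
  have hPz : π (aeval y P) = ∑ α ∈ P.support, z α := by
    rw [aeval_eq_sum_prod, map_sum]
  have hgz : π g = ∑ α ∈ P.support, z α := by
    rw [← hPz, ← sub_eq_zero, ← map_sub]
    exact (hN _).2 hgP
  let R : MvPolynomial (Fin (n + 1)) ℂ := ∑ α ∈ P.support with w α = c, monomial α (P.coeff α)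
  have hRs : ∀ α ∈ R.support, α ∈ P.support ∧ w α = c := by
    intro α hα
    obtain ⟨β, hβ, hαβ⟩ := Finset.mem_biUnion.1 (support_sum hα)
    obtain rfl := Finset.mem_singleton.1 (support_monomial_subset hαβ)
    exact Finset.mem_filter.1 hβ
  refine ⟨R, ?_, fun α hα => (hRs α hα).2, (hN _).1 ?_⟩
  · rw [mem_pow_idealOfVars_iff] at hP ⊢
    exact fun α hα => hP α (hRs α hα).1
  · rw [map_sub, sub_eq_zero, hgz, ← sum_filter_eq_of_mem_eigen P.support (fun α _ => hz α) (hgz ▸ hc), map_sum, map_sum]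
    refine Finset.sum_congr rfl fun α _ => ?_
    rw [aeval_monomial, Finsupp.prod_fintype _ _ fun i => pow_zero _, ← Algebra.smul_def]

end PolynomialApproximation

/-! ### Monomials forced by isolatedness, finite determinacy and the conclusion. -/

section QuasihomogeneousForm

open MvPolynomial

variable {n : ℕ}

theorem aeval_mem_span_sq {y : Fin (n + 1) → O n} {i : Fin (n + 1)}
    {P : MvPolynomial (Fin (n + 1)) ℂ}
    (hP : ∀ α ∈ P.support, 2 ≤ ∑ l ∈ Finset.univ.erase i, α l) :
    aeval y P ∈ Ideal.span (y '' {i}ᶜ) ^ 2 := by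
  rw [aeval_eq_sum_prod]
  refine sum_mem fun α hα => Submodule.smul_of_tower_mem _ _ ?_
  rw [← Finset.mul_prod_erase _ _ (Finset.mem_univ i)]
  refine Ideal.mul_mem_left _ _ (Ideal.pow_le_pow_right (hP α hα) ?_)
  rw [← Finset.prod_pow_eq_pow_sum]
  exact Ideal.prod_mem_prod fun l hl => Ideal.pow_mem_pow
    (Ideal.subset_span (Set.mem_image_of_mem y (Finset.ne_of_mem_erase hl))) _

/-- Otherwise `P(y)` lies in `q²`, where `q` is the ideal of the `yᵢ`-axis, so `F` would be singular
along this axis up to high order: its Tjurina ideal, hence `yᵢ^k`, would lie in `q + 𝔪^(k+1)`.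
Applying `∂/∂yᵢ`, which preserves `q`, `k` times then gives a contradiction. -/
theorem exists_support_sum_erase_le_one {y : Fin (n + 1) → O n} (hy : IsCoordinateSystem y)
    {F : O n} {k : ℕ} (hF : maxIdeal n ^ k ≤ tjurinaIdeal F) {P : MvPolynomial (Fin (n + 1)) ℂ}
    (hP : F - aeval y P ∈ maxIdeal n ^ (k + 2)) (i : Fin (n + 1)) :
    ∃ α ∈ P.support, ∑ l ∈ Finset.univ.erase i, α l ≤ 1 := by
  by_contra! hc
  have hPq := aeval_mem_span_sq (y := y) hc
  set q := Ideal.span (y '' {i}ᶜ)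
  obtain ⟨η, hη⟩ := hy.exists_dual_derivation i
  have hηq : ∀ x ∈ q, η x ∈ q := by
    refine derivation_mem_of_span Ideal.subset_span ?_
    rintro _ ⟨l, hl, rfl⟩
    rw [hη, if_neg (Set.mem_compl_singleton_iff.1 hl)]
    exact q.zero_mem
  have hq : q ≤ maxIdeal n := Ideal.span_le.2 (by rintro _ ⟨l, -, rfl⟩; exact hy.1 l)
  refine pow_notMem_of_isUnit_derivation (δ := η) (J := fun j => q ⊔ maxIdeal n ^ (j + 1))
    (fun j x hx => ?_) (by simpa using hq) (h := y i) (by simp [hη]) k ?_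
  · obtain ⟨a, ha, b, hb, rfl⟩ := Submodule.mem_sup.1 hx
    rw [map_add]
    exact add_mem (Ideal.mem_sup_left (hηq a ha))
      (Ideal.mem_sup_right (derivation_mem_pow η _ _ b hb))
  · have h : tjurinaIdeal F ≤ q ⊔ maxIdeal n ^ (k + 1) := by
      rw [← add_sub_cancel (aeval y P) F]
      refine tjurinaIdeal_le (add_mem (Ideal.mem_sup_left (Ideal.pow_le_self two_ne_zero hPq))
        (Ideal.mem_sup_right (Ideal.pow_le_pow_right (Nat.le_succ _) hP))) fun j => ?_
      rw [map_add]
      refine add_mem (Ideal.mem_sup_left ?_)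
        (Ideal.mem_sup_right (derivation_mem_pow _ _ _ _ hP))
      simpa using derivation_mem_pow (partialDer j) q 1 _ hPq
    exact h (hF (Ideal.pow_mem_pow (hy.1 i) k))

/-- Euler's relation, divided by the weighted degree `r`. -/
theorem aeval_mem_span_pderiv {y : Fin (n + 1) → O n} {w : Fin (n + 1) → ℕ} {r : ℕ}
    {P : MvPolynomial (Fin (n + 1)) ℂ} (hP : P.IsWeightedHomogeneous w r) (hr : r ≠ 0) :
    aeval y P ∈ Ideal.span (Set.range fun i => aeval y (pderiv i P)) := by
  have h := congrArg (aeval y) hP.sum_weight_X_mul_pderiv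
  rw [map_nsmul, ← Nat.cast_smul_eq_nsmul ℂ] at h
  have hr' : (r : ℂ) ≠ 0 := Nat.cast_ne_zero.2 hr
  rw [← inv_smul_smul₀ hr' (aeval y P), ← h, map_sum]
  refine Submodule.smul_of_tower_mem _ _ (sum_mem fun i _ => ?_)
  rw [map_nsmul, map_mul]
  exact Submodule.smul_of_tower_mem _ _ (Ideal.mul_mem_left _ _ (Ideal.subset_span ⟨i, rfl⟩))

theorem aeval_pderiv_mem_maxIdeal {y : Fin (n + 1) → O n} (hy : ∀ i, y i ∈ maxIdeal n)
    {P : MvPolynomial (Fin (n + 1)) ℂ} (hP : P ∈ idealOfVars (Fin (n + 1)) ℂ ^ 2)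
    (i : Fin (n + 1)) : aeval y (pderiv i P) ∈ maxIdeal n := by
  have h : idealOfVars (Fin (n + 1)) ℂ ≤ (maxIdeal n).comap (aeval y) := by
    refine Ideal.span_le.2 ?_
    rintro _ ⟨j, rfl⟩
    simpa using hy j
  exact h (by simpa using derivation_mem_pow (pderiv i) _ 1 P hP)

/-- Finite determinacy. Let `J` be the ideal of partials of `P` at `y`. As `P(y) ∈ J` by Euler, the
Tjurina ideal of `F` lies in `J + 𝔪^(k+1)`, so Nakayama gives `𝔪^k ⊆ J`. Then `𝔪^(2k+2) ⊆ 𝔪 (𝔪^k)² ⊆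
𝔪 J²`. -/
theorem exists_eq_aeval_of_isWeightedHomogeneous {y : Fin (n + 1) → O n}
    (hy : IsCoordinateSystem y) {F : O n} {k : ℕ} (hF : maxIdeal n ^ k ≤ tjurinaIdeal F)
    {P : MvPolynomial (Fin (n + 1)) ℂ} (hFP : F - aeval y P ∈ maxIdeal n ^ (2 * k + 2))
    (hP2 : P ∈ idealOfVars (Fin (n + 1)) ℂ ^ 2) {w : Fin (n + 1) → ℕ} {r : ℕ}
    (hP : P.IsWeightedHomogeneous w r) (hr : r ≠ 0) :
    ∃ y' : Fin (n + 1) → O n, IsCoordinateSystem y' ∧ F = aeval y' P := by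
  refine exists_coordinateSystem_of_sub_mem hy P (aeval_pderiv_mem_maxIdeal hy.1 hP2) ?_
  set J := Ideal.span (Set.range fun i => aeval y (pderiv i P))
  have hJ : maxIdeal n ^ k ≤ J := by
    refine Submodule.le_of_le_smul_of_le_jacobson_bot (Ideal.FG.pow maxIdeal_fg)
      maxIdeal_le_jacobson_bot ?_
    rw [smul_eq_mul, ← pow_succ']
    refine hF.trans ?_
    have hFP' : F - aeval y P ∈ maxIdeal n ^ (k + 1 + 1) :=
      Ideal.pow_le_pow_right (by omega) hFP
    rw [← add_sub_cancel (aeval y P) F]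
    refine tjurinaIdeal_le (add_mem (Ideal.mem_sup_left (aeval_mem_span_pderiv hP hr))
      (Ideal.mem_sup_right (Ideal.pow_le_pow_right (Nat.le_succ _) hFP'))) fun j => ?_
    rw [map_add, derivation_aeval]
    exact add_mem (Ideal.mem_sup_left (sum_mem fun i _ =>
        Ideal.mul_mem_right _ _ (Ideal.subset_span ⟨i, rfl⟩)))
      (Ideal.mem_sup_right (derivation_mem_pow _ _ _ _ hFP'))
  have h : maxIdeal n ^ (2 * k + 2) ≤ maxIdeal n * (maxIdeal n ^ k) ^ 2 := by
    rw [← pow_mul, ← pow_succ']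
    exact Ideal.pow_le_pow_right (by omega)
  exact (h.trans (Ideal.mul_mono_right (Ideal.pow_right_mono hJ 2))) hFP

theorem isQuasihomogeneous_of_not_isNilpotent {f : O n} (hf : f ∈ maxIdeal n ^ 3) {k : ℕ}
    (hk : maxIdeal n ^ k ≤ tjurinaIdeal f) {δ : Derivation ℂ (O n) (O n)}
    (hδ : δ f ∈ Ideal.span {f}) (hδc : ∀ i, δ (coord i) ∈ maxIdeal n)
    (hnil : ¬ IsNilpotent (jacobianAtZero fun i => δ (coord i))) : IsQuasihomogeneous f := by
  classical
  -- The exponent `2k+2` is at least `2` (linear parts are visible), at least `k+2` (forced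
  -- monomials), and large enough for finite determinacy.
  obtain ⟨Q, _, _, π, hπ, hN⟩ := exists_quotient_algebra (maxIdeal n ^ (2 * k + 2))
  have := finiteDimensional_of_surjective hπ hN
  obtain ⟨D, hD⟩ := exists_jet_derivation hπ hN hδc
  -- Otherwise `𝔪^k` would lie in the Tjurina ideal, hence in `𝔪^(2k+1) ⊆ 𝔪^(k+1)`.
  have hfN : f ∉ maxIdeal n ^ (2 * k + 2) := fun h => maxIdeal_pow_not_le_succ k
    ((hk.trans (tjurinaIdeal_le_pow h)).trans (Ideal.pow_le_pow_right (by omega)))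
  obtain ⟨u, c, hu⟩ := exists_unit_mul_mem_eigen hN hD hδ hfN
  obtain ⟨y, l, hy, hl⟩ := exists_coordinateSystem_eigen hN hδc (by omega) hD
  have hl0 : l ≠ 0 := by
    rintro rfl
    exact hnil (isNilpotent_jacobianAtZero_of_mem_eigen_zero hN hδc (by omega) hD hy hl)
  obtain ⟨P, hP3, hPc, hPF⟩ := exists_aeval_sub_mem_of_mem_eigen hN hy.span_eq hl
    (Ideal.mul_mem_left _ (u : O n) hf) hu
  have hku : maxIdeal n ^ k ≤ tjurinaIdeal ((u : O n) * f) :=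
    hk.trans (tjurinaIdeal_le_of_mem_span
      (Ideal.mem_span_singleton'.2 ⟨(u⁻¹ : (O n)ˣ), by rw [Units.inv_mul_cancel_left]⟩))
  obtain ⟨w, r, hw, hr, hwr⟩ := exists_weights hl0 (c := c) fun i => by
    obtain ⟨α, hα, h1⟩ := exists_support_sum_erase_le_one hy hku
      (Ideal.pow_le_pow_right (by omega) hPF) i
    have h3 := (mem_pow_idealOfVars_iff 3 P).1 hP3 α hα
    rw [Finsupp.degree_eq_sum] at h3
    obtain ⟨a, ha, j, hj⟩ := exists_sum_mul_eq_mul_add i α h1 h3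
    exact ⟨a, ha, j, (hj l).symm.trans (hPc α hα)⟩
  have hPw : P.IsWeightedHomogeneous w r := by
    intro α hα
    rw [Finsupp.weight_apply, Finsupp.sum_fintype _ _ fun i => zero_smul ℕ (w i)]
    exact hwr α (hPc α (mem_support_iff.2 hα))
  obtain ⟨y', hy', hF⟩ := exists_eq_aeval_of_isWeightedHomogeneous hy hku hPF
    (Ideal.pow_le_pow_right (by norm_num) hP3) hPw hr
  exact ⟨y', u, w, r, P, hy', hw, hPw, hF⟩

end QuasihomogeneousForm

end IsolatedSing

end

theorem mainTheorem4 (n : ℕ) (f : IsolatedSing.O n)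
    (hred : (Ideal.span {f}).IsRadical)
    (hiso : IsolatedSing.HasIsolatedSingularity f)
    (hord : f ∈ IsolatedSing.maxIdeal n ^ 3)
    (hnqh : ¬ IsolatedSing.IsQuasihomogeneous f) :
    ∀ δ ∈ IsolatedSing.logDer f, IsolatedSing.IsNilpotentVectorField δ := by
  intro δ hδ
  obtain ⟨k, hk⟩ := hiso.exists_pow_le
  have hc := IsolatedSing.logDer_coord_mem (Ideal.pow_le_pow_right (by norm_num) hord) hk hδ
  refine ⟨hc, ?_⟩
  by_contra h
  exact hnqh (IsolatedSing.isQuasihomogeneous_of_not_isNilpotent hord hk hδ hc h)
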